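/- Let $M$ be a connected smooth manifold without boundary (Hausdorff, second countable, finite dimensional), let $d\ge 0$ and $\kappa\ge 1$ be integers, and let $V:\mathbb{R}^d\to\Gamma(TM)$ be a linear map into the smooth vector fields on $M$. Notation. Let $T^{(\kappa)}(\mathbb{R}^d)=\bigoplus_{k=0}^{\kappa}(\mathbb{R}^d)^{\otimes k}\subset T(\mathbb{R}^d)$ be the truncated tensor algebra, with the tensor product truncated at degree $\kappa$, and let $F^{(\kappa)}(\mathbb{R}^d)$ be the Lie subalgebra of it (for the commutator bracket) generated by $\mathbb{R}^d$. Put $e^A=\sum_{k=0}^{\kappa}A^k/k!$ and $\log g=\sum_{k=1}^{\kappa}\frac{(-1)^{k+1}}{k}(g-1)^k$. Extend $V$ to the algebra homomorphism from the tensor algebra $T(\mathbb{R}^d)$ to the linear operators on $C^\infty(M,\mathbb{R})$; for $A\in F^{(\kappa)}(\mathbb{R}^d)$ let $V_A\in\Gamma(TM)$ be the vector field that is the image of $A\in T(\mathbb{R}^d)$. For $T>0$ and $\xi\in C^1([0,T],F^{(\kappa)}(\mathbb{R}^d))$ let $g^\xi$ be the solution of $\dot g^\xi(t)=g^\xi(t)\dot\xi(t)$,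 $g^\xi(0)=1$ on $[0,T]$, and let $C^\xi(t)=\log g^\xi(t)$. A time dependent vector field $Y$ on a time interval $J$ is complete if for all $s\in J$ and $m\in M$ the equation $\dot\sigma(t)=Y_t(\sigma(t))$, $\sigma(s)=m$, has a solution $\sigma:J\to M$; then $\mu^Y_{t,s}(m)=\sigma(t)$ denotes its flow, and $e^Y=\mu^Y_{1,0}$ if $Y$ does not depend on time. Assume that $V$ is $\kappa$-complete, that is, for every $T>0$ and every $\xi\in C^1([0,T],F^{(\kappa)}(\mathbb{R}^d))$ the time dependent vector field $t\mapsto V_{\dot\xi(t)}$ is complete on $[0,T]$. Assume further that $\{V_a:a\in\mathbb{R}^d\}$ generates a step-$\kappa$ nilpotent Lie subalgebra of $\Gamma(TM)$, that is, $\operatorname{ad}_{V_{a_\kappa}}\cdots\operatorname{ad}_{V_{a_1}}V_{a_0}=0$ for all $a_0,\dots,a_\kappa\in\mathbb{R}^d$. Then for all $T>0$, all $\xi\in C^1([0,T],F^{(\kappa)}(\mathbb{R}^d))$ and all $t\in[0,T]$ one has $C^\xi(t)\in F^{(\kappa)}(\mathbb{R}^d)$ and $$\mu^{V_{\dot\xi}}_{t,0}=e^{V_{C^\xi(t)}}.$$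 Moreover, for all $A,B\in F^{(\kappa)}(\mathbb{R}^d)$ one has $\log(e^Ae^B)\in F^{(\kappa)}(\mathbb{R}^d)$ and $$e^{V_B}\circ e^{V_A}=e^{V_{\log(e^Ae^B)}}.$$ -/

import Mathlib

open Set
open scoped Manifold ContDiff

noncomputable section

/-! ### The truncated tensor algebra `T^(κ)(ℝ^d)` -/

/-- Words of length at most `κ` in the letters `0, …, d-1`. The word `i₁ … i_k` labels the basis
element `e_{i₁} ⊗ … ⊗ e_{i_k}` of the `k`-th tensor power of `ℝ^d`. -/
abbrev Word (d κ : ℕ) : Type := {w : List (Fin d) // w.length ≤ κ}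

instance Word.instFinite (d κ : ℕ) : Finite (Word d κ) :=
  (List.finite_length_le (Fin d) κ).to_subtype

instance Word.instFintype (d κ : ℕ) : Fintype (Word d κ) := Fintype.ofFinite _

/-- The first `i` letters of a word. -/
def Word.take {d κ : ℕ} (i : ℕ) (w : Word d κ) : Word d κ :=
  ⟨w.1.take i, (List.length_take_le' i w.1).trans w.2⟩

/-- The word without its first `i` letters. -/
def Word.drop {d κ : ℕ} (i : ℕ) (w : Word d κ) : Word d κ :=
  ⟨w.1.drop i, by have := w.2; simp; omega⟩

/-- The step-`κ` truncated tensor algebra `⨁_{k ≤ κ} (ℝ^d)^{⊗k}`, an element being given by its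
coordinates in the basis of words of length at most `κ`. -/
def TruncTensor (d κ : ℕ) : Type := Word d κ → ℝ

namespace TruncTensor

variable {d κ : ℕ}

instance instNormedAddCommGroup : NormedAddCommGroup (TruncTensor d κ) :=
  inferInstanceAs (NormedAddCommGroup (Word d κ → ℝ))

instance instNormedSpace : NormedSpace ℝ (TruncTensor d κ) :=
  inferInstanceAs (NormedSpace ℝ (Word d κ → ℝ))

instance instFiniteDimensional : FiniteDimensional ℝ (TruncTensor d κ) :=
  inferInstanceAs (FiniteDimensional ℝ (Word d κ → ℝ))

@[ext] theorem ext {A B : TruncTensor d κ} (h : ∀ w, A w = B w) : A = B := funext h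

@[simp] theorem zero_apply (w : Word d κ) : (0 : TruncTensor d κ) w = 0 := rfl
@[simp] theorem add_apply (A B : TruncTensor d κ) (w : Word d κ) : (A + B) w = A w + B w := rfl
@[simp] theorem smul_apply (c : ℝ) (A : TruncTensor d κ) (w : Word d κ) :
    (c • A) w = c * A w := rfl

/-- The unit: the empty word. -/
instance instOne : One (TruncTensor d κ) := ⟨fun w => if w.1 = [] then 1 else 0⟩

/-- The tensor product, truncated at degree `κ`: words are multiplied by concatenation, so the
coefficient of `w` in `A * B` is the sum of `A u * B v` over all factorisations `w = u v`. -/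
instance instMul : Mul (TruncTensor d κ) :=
  ⟨fun A B w => ∑ i ∈ Finset.range (w.1.length + 1), A (w.take i) * B (w.drop i)⟩

theorem one_apply (w : Word d κ) : (1 : TruncTensor d κ) w = if w.1 = [] then 1 else 0 := rfl

theorem mul_apply (A B : TruncTensor d κ) (w : Word d κ) :
    (A * B) w = ∑ i ∈ Finset.range (w.1.length + 1), A (w.take i) * B (w.drop i) := rfl

protected theorem one_mul (A : TruncTensor d κ) : 1 * A = A := by
  ext w
  rw [mul_apply, Finset.sum_eq_single 0]
  · simp [one_apply, Word.take, Word.drop]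
  · intro i hi h0
    have : w.1.take i ≠ [] := by
      intro h
      have := congrArg List.length h
      simp at this hi
      rcases this with h | h
      · exact h0 h
      · rw [h] at hi; simp at hi; exact h0 hi
    simp [one_apply, Word.take, this]
  · simp

protected theorem mul_one (A : TruncTensor d κ) : A * 1 = A := by
  ext w
  rw [mul_apply, Finset.sum_eq_single w.1.length]
  · simp [one_apply, Word.take, Word.drop]
  · intro i hi h0
    have : w.1.drop i ≠ [] := by
      intro h
      have := congrArg List.length h
      simp at this hi
      omega
    simp [one_apply, Word.drop, this]
  · simp

protected theorem mul_assoc (A B C : TruncTensor d κ) : A * B * C = A * (B * C) := by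
  ext w
  simp only [mul_apply, Finset.sum_mul, Finset.mul_sum]
  rw [Finset.sum_sigma', Finset.sum_sigma']
  refine Finset.sum_nbij' (fun p => ⟨p.2, p.1 - p.2⟩) (fun p => ⟨p.1 + p.2, p.1⟩) ?_ ?_ ?_ ?_ ?_
  · rintro ⟨j, i⟩ h
    simp [Word.take, Word.drop] at h ⊢
    omega
  · rintro ⟨i, j⟩ h
    simp [Word.take, Word.drop] at h ⊢
    omega
  · rintro ⟨j, i⟩ h
    simp [Word.take] at h ⊢
    omega
  · rintro ⟨i, j⟩ h
    simp
  · rintro ⟨j, i⟩ h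
    simp [Word.take] at h
    have hij : i ≤ j := by omega
    have e1 : (w.take j).take i = w.take i := by
      apply Subtype.ext; simp [Word.take, List.take_take, hij]
    have e2 : (w.take j).drop i = (w.drop i).take (j - i) := by
      apply Subtype.ext; simp [Word.take, Word.drop, List.drop_take]
    have e3 : w.drop j = (w.drop i).drop (j - i) := by
      apply Subtype.ext; simp [Word.drop, hij]
    simp only [e1, e2, e3, _root_.mul_assoc]

instance instRing : Ring (TruncTensor d κ) :=
  { (inferInstance : AddCommGroup (TruncTensor d κ)) with
    mul := (· * ·)
    one := 1
    one_mul := TruncTensor.one_mul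
    mul_one := TruncTensor.mul_one
    mul_assoc := TruncTensor.mul_assoc
    zero_mul := fun A => by ext w; simp [mul_apply]
    mul_zero := fun A => by ext w; simp [mul_apply]
    left_distrib := fun A B C => by
      ext w; simp [mul_apply, mul_add, Finset.sum_add_distrib]
    right_distrib := fun A B C => by
      ext w; simp [mul_apply, add_mul, Finset.sum_add_distrib] }

instance instAlgebra : Algebra ℝ (TruncTensor d κ) :=
  Algebra.ofModule
    (fun c A B => by ext w; simp [mul_apply, Finset.mul_sum, _root_.mul_assoc])
    (fun c A B => by ext w; simp [mul_apply, Finset.mul_sum, mul_left_comm])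

/-- The commutator bracket `[A, B] = A * B - B * A`. -/
instance instLieRing : LieRing (TruncTensor d κ) := LieRing.ofAssociativeRing

instance instLieAlgebra : LieAlgebra ℝ (TruncTensor d κ) := LieAlgebra.ofAssociativeAlgebra

/-- The inclusion of `ℝ^d` into the truncated tensor algebra, as the words of length one. -/
def ofVec (d κ : ℕ) (a : Fin d → ℝ) : TruncTensor d κ :=
  fun w => ∑ i : Fin d, if w.1 = [i] then a i else 0

/-- The free step-`κ` nilpotent Lie algebra `F^(κ)(ℝ^d)`: the Lie subalgebra of the truncated
tensor algebra, with its commutator bracket, generated by `ℝ^d`. -/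
def freeNilpotent (d κ : ℕ) : LieSubalgebra ℝ (TruncTensor d κ) :=
  LieSubalgebra.lieSpan ℝ (TruncTensor d κ) (Set.range (ofVec d κ))

/-- The exponential `∑_{k ≤ κ} A^k / k!`. -/
def exp (A : TruncTensor d κ) : TruncTensor d κ :=
  ∑ k ∈ Finset.range (κ + 1), ((k.factorial : ℝ)⁻¹) • A ^ k

/-- The logarithm `∑_{1 ≤ k ≤ κ} (-1)^(k+1)/k (g - 1)^k`. -/
def log (g : TruncTensor d κ) : TruncTensor d κ :=
  ∑ k ∈ Finset.Icc 1 κ, ((-1 : ℝ) ^ (k + 1) / k) • (g - 1) ^ k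

/-- The linear inclusion of `T^(κ)(ℝ^d)` into the full tensor algebra `T(ℝ^d)`, which sends the
word `i₁ … i_k` to `e_{i₁} ⊗ … ⊗ e_{i_k}`. -/
def toTensor (A : TruncTensor d κ) : TensorAlgebra ℝ (Fin d → ℝ) :=
  ∑ w : Word d κ,
    A w • (w.1.map fun i => TensorAlgebra.ι ℝ (Pi.single i (1 : ℝ) : Fin d → ℝ)).prod

/-- `ξ ∈ C¹([0,T], F^(κ)(ℝ^d))`. -/
def IsC1Path (T : ℝ) (ξ : ℝ → TruncTensor d κ) : Prop :=
  ContDiffOn ℝ 1 ξ (Icc 0 T) ∧ ∀ t ∈ Icc 0 T, ξ t ∈ freeNilpotent d κ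

/-- The velocity `ξ̇(t)` of a path on `[0,T]` (one-sided at the end points). -/
def velocity (T : ℝ) (ξ : ℝ → TruncTensor d κ) (t : ℝ) : TruncTensor d κ :=
  derivWithin ξ (Icc 0 T) t

/-- `g` solves `ġ(t) = g(t) ξ̇(t)` on `[0,T]` with `g(0) = 1`. -/
def IsDevelopment (T : ℝ) (ξ g : ℝ → TruncTensor d κ) : Prop :=
  g 0 = 1 ∧ ∀ t ∈ Icc 0 T, HasDerivWithinAt g (g t * velocity T ξ t) (Icc 0 T) t

open Classical in
/-- The path `g^ξ`: the solution on `[0,T]` of the linear equation `ġ = g ξ̇`, `g(0) = 1`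
(its values outside `[0,T]` are irrelevant). -/
def development (T : ℝ) (ξ : ℝ → TruncTensor d κ) : ℝ → TruncTensor d κ :=
  if h : ∃ g, IsDevelopment T ξ g then h.choose else fun _ => 1

/-- `C^ξ(t) = log g^ξ(t)`. -/
def logDevelopment (T : ℝ) (ξ : ℝ → TruncTensor d κ) (t : ℝ) : TruncTensor d κ :=
  log (development T ξ t)

end TruncTensor

/-! ### Vector fields, differential operators and flows -/

section Manifold

variable (E : Type*) [NormedAddCommGroup E] [NormedSpace ℝ E]
  (M : Type*) [TopologicalSpace M] [ChartedSpace E M]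

/-- Not necessarily smooth vector fields on `M`. -/
abbrev RoughVectorField : Type _ := (x : M) → TangentSpace 𝓘(ℝ, E) x

variable {E M}

/-- `σ` solves the ordinary differential equation `σ̇(t) = Y_t(σ(t))` on `J`, with one-sided
derivatives at the end points of `J`. -/
def SolvesODEOn (Y : ℝ → RoughVectorField E M) (J : Set ℝ) (σ : ℝ → M) : Prop :=
  ∀ t ∈ J, HasMFDerivWithinAt 𝓘(ℝ, ℝ) 𝓘(ℝ, E) σ J t
    ((1 : ℝ →L[ℝ] ℝ).smulRight (Y t (σ t)))

/-- The time dependent vector field `Y` is complete on the time interval `J`. -/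
def IsCompleteOn (Y : ℝ → RoughVectorField E M) (J : Set ℝ) : Prop :=
  ∀ s ∈ J, ∀ m : M, ∃ σ : ℝ → M, σ s = m ∧ SolvesODEOn Y J σ

open Classical in
/-- The flow `μ_{t,s}^Y` on the time interval `J`: `μ_{t,s}^Y(m) = σ(t)`, where `σ` solves
`σ̇ = Y_t(σ)` on `J` with `σ(s) = m`. It is only used for complete `Y`. -/
def flow (Y : ℝ → RoughVectorField E M) (J : Set ℝ) (t s : ℝ) (m : M) : M :=
  if h : ∃ σ : ℝ → M, σ s = m ∧ SolvesODEOn Y J σ then h.choose t else m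

/-- `e^Y`, the time one flow of a time independent vector field. -/
def expFlow (Y : RoughVectorField E M) : M → M := flow (fun _ => Y) univ 1 0

variable [IsManifold 𝓘(ℝ, E) ∞ M]

variable (E M) in
/-- The space `Γ(TM)` of smooth vector fields. -/
abbrev SmoothVectorField : Type _ :=
  ContMDiffSection 𝓘(ℝ, E) E ∞ (TangentSpace 𝓘(ℝ, E) : M → Type _)

theorem SmoothVectorField.contMDiff_mfderiv_apply (X : SmoothVectorField E M)
    (f : C^∞⟮𝓘(ℝ, E), M; ℝ⟯) :
    ContMDiff 𝓘(ℝ, E) 𝓘(ℝ, ℝ) ∞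
      (fun x => (mfderiv 𝓘(ℝ, E) 𝓘(ℝ, ℝ) f x (X x) : ℝ)) := by
  have h1 := (f.contMDiff.contMDiff_tangentMap (m := ∞) le_rfl).comp X.contMDiff
  exact (contMDiff_snd_tangentBundle_modelSpace ℝ 𝓘(ℝ, ℝ)).comp h1

/-- A smooth vector field as a differential operator on `C^∞(M, ℝ)`: `(X f)(x) = df_x(X(x))`. -/
def SmoothVectorField.toOperator :
    SmoothVectorField E M →ₗ[ℝ] Module.End ℝ C^∞⟮𝓘(ℝ, E), M; ℝ⟯ where
  toFun X :=
    { toFun := fun f => ⟨fun x => (mfderiv 𝓘(ℝ, E) 𝓘(ℝ, ℝ) f x (X x) : ℝ),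
        X.contMDiff_mfderiv_apply f⟩
      map_add' := fun f g => by
        ext x
        have hf := (f.contMDiff.mdifferentiable (by simp)) x
        have hg := (g.contMDiff.mdifferentiable (by simp)) x
        exact congrArg (fun L => (L : TangentSpace 𝓘(ℝ, E) x →L[ℝ] ℝ) (X x)) (mfderiv_add hf hg)
      map_smul' := fun c f => by
        ext x
        have hf := (f.contMDiff.mdifferentiable (by simp)) x
        exact congrArg (fun L => (L : TangentSpace 𝓘(ℝ, E) x →L[ℝ] ℝ) (X x))
          (const_smul_mfderiv hf c) }
  map_add' X Y := by
    ext f x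
    exact map_add (mfderiv 𝓘(ℝ, E) 𝓘(ℝ, ℝ) f x) (X x) (Y x)
  map_smul' c X := by
    ext f x
    exact map_smul (mfderiv 𝓘(ℝ, E) 𝓘(ℝ, ℝ) f x) c (X x)

/-- The iterated bracket `ad_{V_{a_1}} … ad_{V_{a_k}} V_{a_0}` of the list `[a_1, …, a_k]`. -/
def iteratedBracket {d : ℕ} (V : (Fin d → ℝ) →ₗ[ℝ] SmoothVectorField E M) (a₀ : Fin d → ℝ) :
    List (Fin d → ℝ) → RoughVectorField E M
  | [] => ⇑(V a₀)
  | a :: l => VectorField.mlieBracket 𝓘(ℝ, E) (⇑(V a)) (iteratedBracket V a₀ l)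

/-- `{V_a : a ∈ ℝ^d}` generates a step-`κ` nilpotent Lie subalgebra of `Γ(TM)`: all brackets
`ad_{V_{a_κ}} … ad_{V_{a_1}} V_{a_0}` vanish. -/
def GeneratesNilpotent {d : ℕ} (κ : ℕ) (V : (Fin d → ℝ) →ₗ[ℝ] SmoothVectorField E M) : Prop :=
  ∀ (a₀ : Fin d → ℝ) (l : List (Fin d → ℝ)), l.length = κ → iteratedBracket V a₀ l = 0

/-- The unique extension of the dynamical system `V : ℝ^d → Γ(TM)` to an algebra homomorphism from
the tensor algebra `T(ℝ^d)` to the algebra of linear operators on `C^∞(M, ℝ)`. -/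
def extendToTensor {d : ℕ} (V : (Fin d → ℝ) →ₗ[ℝ] SmoothVectorField E M) :
    TensorAlgebra ℝ (Fin d → ℝ) →ₐ[ℝ] Module.End ℝ C^∞⟮𝓘(ℝ, E), M; ℝ⟯ :=
  TensorAlgebra.lift ℝ (SmoothVectorField.toOperator ∘ₗ V)

open Classical in
/-- The vector field `V_A` for `A ∈ F^(κ)(ℝ^d) ⊆ T(ℝ^d)`: the smooth vector field which, as a
differential operator, is the image of `A` under the extension of `V` to the tensor algebra. (The
image of any such `A` is a linear combination of iterated commutators of the operators `V_a`, hence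
is a vector field. The value for other `A` is irrelevant.) -/
def extendVF {d κ : ℕ} (V : (Fin d → ℝ) →ₗ[ℝ] SmoothVectorField E M) (A : TruncTensor d κ) :
    SmoothVectorField E M :=
  if h : ∃ X : SmoothVectorField E M, X.toOperator = extendToTensor V A.toTensor then h.choose
  else 0

/-- The time dependent vector field `t ↦ V_{ξ̇(t)}` on `[0,T]`. -/
def velocityField {d κ : ℕ} (V : (Fin d → ℝ) →ₗ[ℝ] SmoothVectorField E M) (T : ℝ)
    (ξ : ℝ → TruncTensor d κ) (t : ℝ) : RoughVectorField E M :=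
  ⇑(extendVF V (TruncTensor.velocity T ξ t))

/-- The dynamical system `V` is `κ`-complete: for every path `ξ ∈ C¹([0,T], F^(κ)(ℝ^d))` the time
dependent vector field `V_{ξ̇(t)}` is complete on `[0,T]`. -/
def IsKappaComplete {d : ℕ} (κ : ℕ) (V : (Fin d → ℝ) →ₗ[ℝ] SmoothVectorField E M) : Prop :=
  ∀ (T : ℝ), 0 < T → ∀ ξ : ℝ → TruncTensor d κ, TruncTensor.IsC1Path T ξ →
    IsCompleteOn (velocityField V T ξ) (Icc 0 T)

end Manifold

end

/-!
# Flows of nilpotent systems of vector fields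

The map `A ↦ V_A` from truncated tensors to differential operators does not respect the truncated
product. On the free nilpotent Lie algebra `F` it does respect brackets: `F` is spanned by
right-normed brackets of vectors, and those of more than `κ` vectors vanish in the truncated tensor
algebra and, by nilpotency, among the vector fields (`TruncTensor.map_toTensor_lie`). In particular
`V_A` is a vector field for `A` in `F`.

Let `g' = g b` with `b` in `F`, and let `c = log g`. The derivative of the exponential map is given
by the series `dexp`, so that `b = (1 - e^{-ad c}) / ad c` applied to `c'`
(`TruncTensor.sum_exp_deriv_eq`). Since `c' = b + ½ [c, c'] - …` and brackets raise the degree, it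
follows by induction over the degree that `c` and `c'` stay in `F`
(`TruncTensor.exists_hasDerivWithinAt_log_of_development`).

Now let `σ' = V_b(σ)` on the manifold. The claim is that the curve `t ↦ e^{-V_{c(t)}} (σ t)` is
constant, and it suffices that its velocity vanishes. By the first variation formula
(`hasVelocityWithinAt_of_variation`) the velocity at `t` is the value at `s = 1` of the solution
`Z_s` of `∂ₛ Z - [V_c, Z] = -V_{c'}` with `Z_0 = V_b`. Since `A ↦ V_A` respects brackets, this
solution is the image of `s ↦ dexp c c' (1 - s)`, which vanishes at `s = 1`
(`eq_expFlow_log_of_development`). The variation formula is derived from a Gronwall estimate between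
the flow and the explicit approximate solution given by `Z` (`norm_sub_variation_le`), so that
smooth dependence of flows on parameters is not needed.

The first claim of the theorem is the case `b = ξ'`, `g 0 = 1`. The second one is the case
`g t = e^A e^{tB}`, in which `b = B` is constant and `σ` is an integral curve of `V_B` which starts
at `e^{V_A} (m)`.
-/

noncomputable section

namespace TruncTensor

variable {d κ : ℕ}

/-! ### The filtration of the truncated tensor algebra by degree -/

/-- The tensors all of whose components have degree at least `k`. -/
def degGE (d κ k : ℕ) : Submodule ℝ (TruncTensor d κ) where
  carrier := {A | ∀ w : Word d κ, w.1.length < k → A w = 0}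
  add_mem' := fun hA hB w hw => by simp [hA w hw, hB w hw]
  zero_mem' := fun w _ => rfl
  smul_mem' := fun c A hA w hw => by simp [hA w hw]

theorem mem_degGE_zero (A : TruncTensor d κ) : A ∈ degGE d κ 0 :=
  fun _ hw => absurd hw (Nat.not_lt_zero _)

theorem degGE_mono {i j : ℕ} (h : i ≤ j) : degGE d κ j ≤ degGE d κ i :=
  fun _ hA w hw => hA w (hw.trans_le h)

theorem eq_zero_of_mem_degGE {k : ℕ} (hk : κ < k) {A : TruncTensor d κ} (hA : A ∈ degGE d κ k) :
    A = 0 := by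
  ext w
  exact hA w (w.2.trans_lt hk)

theorem mul_mem_degGE {i j : ℕ} {A B : TruncTensor d κ} (hA : A ∈ degGE d κ i)
    (hB : B ∈ degGE d κ j) : A * B ∈ degGE d κ (i + j) := by
  intro w hw
  rw [mul_apply]
  refine Finset.sum_eq_zero fun n hn => ?_
  rw [Finset.mem_range] at hn
  by_cases h : n < i
  · rw [hA _ (by simp [Word.take]; omega), zero_mul]
  · rw [hB _ (by simp [Word.drop]; omega), mul_zero]

theorem mul_mem_degGE_left {j : ℕ} (A : TruncTensor d κ) {B : TruncTensor d κ}
    (hB : B ∈ degGE d κ j) : A * B ∈ degGE d κ j := by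
  simpa using mul_mem_degGE (mem_degGE_zero A) hB

theorem mul_mem_degGE_right {j : ℕ} {A : TruncTensor d κ} (B : TruncTensor d κ)
    (hA : A ∈ degGE d κ j) : A * B ∈ degGE d κ j := by
  simpa using mul_mem_degGE hA (mem_degGE_zero B)

theorem lie_mem_degGE {i j : ℕ} {A B : TruncTensor d κ} (hA : A ∈ degGE d κ i)
    (hB : B ∈ degGE d κ j) : ⁅A, B⁆ ∈ degGE d κ (i + j) := by
  rw [LieRing.of_associative_ring_bracket]
  exact sub_mem (mul_mem_degGE hA hB) (add_comm j i ▸ mul_mem_degGE hB hA)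

theorem pow_mem_degGE {A : TruncTensor d κ} (hA : A ∈ degGE d κ 1) (k : ℕ) :
    A ^ k ∈ degGE d κ k := by
  induction k with
  | zero => exact mem_degGE_zero _
  | succ k ih => rw [pow_succ]; exact mul_mem_degGE ih hA

theorem pow_eq_zero {A : TruncTensor d κ} (hA : A ∈ degGE d κ 1) {k : ℕ} (hk : κ < k) :
    A ^ k = 0 :=
  eq_zero_of_mem_degGE hk (pow_mem_degGE hA k)

theorem pow_mem_degGE_one {A : TruncTensor d κ} (hA : A ∈ degGE d κ 1) {k : ℕ} (hk : k ≠ 0) :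
    A ^ k ∈ degGE d κ 1 :=
  degGE_mono (Nat.one_le_iff_ne_zero.2 hk) (pow_mem_degGE hA k)

/-- The tensors without component of degree zero, as a Lie subalgebra. -/
def augmentation (d κ : ℕ) : LieSubalgebra ℝ (TruncTensor d κ) :=
  { degGE d κ 1 with
    lie_mem' := fun hA hB => degGE_mono (by norm_num) (lie_mem_degGE hA hB) }

theorem freeNilpotent_le_augmentation : freeNilpotent d κ ≤ augmentation d κ := by
  refine LieSubalgebra.lieSpan_le.2 ?_
  rintro _ ⟨a, rfl⟩ w hw
  have : w.1 = [] := List.length_eq_zero_iff.1 (by omega)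
  simp [ofVec, this]

theorem mem_degGE_one_of_mem_freeNilpotent {A : TruncTensor d κ} (hA : A ∈ freeNilpotent d κ) :
    A ∈ degGE d κ 1 :=
  freeNilpotent_le_augmentation hA

theorem exp_sub_one_mem {A : TruncTensor d κ} (hA : A ∈ degGE d κ 1) :
    exp A - 1 ∈ degGE d κ 1 := by
  rw [exp, Finset.sum_range_succ']
  simp only [Nat.factorial_zero, Nat.cast_one, inv_one, pow_zero, one_smul, add_sub_cancel_right]
  exact Submodule.sum_mem _ fun k _ => Submodule.smul_mem _ _ (pow_mem_degGE_one hA k.succ_ne_zero)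

theorem log_mem {g : TruncTensor d κ} (hg : g - 1 ∈ degGE d κ 1) : log g ∈ degGE d κ 1 :=
  Submodule.sum_mem _ fun k hk => Submodule.smul_mem _ _
    (pow_mem_degGE_one hg (by have := (Finset.mem_Icc.1 hk).1; omega))

theorem mul_sub_one_mem {g h : TruncTensor d κ} (hg : g - 1 ∈ degGE d κ 1)
    (hh : h - 1 ∈ degGE d κ 1) : g * h - 1 ∈ degGE d κ 1 := by
  have : g * h - 1 = (g - 1) * h + (h - 1) := by noncomm_ring
  rw [this]
  exact add_mem (mul_mem_degGE_right _ hg) hh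

theorem exp_zero : exp (0 : TruncTensor d κ) = 1 := by
  rw [exp, Finset.sum_eq_single 0] <;> simp +contextual

theorem log_one : log (1 : TruncTensor d κ) = 0 := by
  rw [log]
  refine Finset.sum_eq_zero fun k hk => ?_
  have : k ≠ 0 := by have := (Finset.mem_Icc.1 hk).1; omega
  simp [this]

/-- Left multiplication by a unipotent element is injective. -/
theorem eq_zero_of_unipotent_mul {u X : TruncTensor d κ} (hu : u - 1 ∈ degGE d κ 1)
    (h : u * X = 0) : X = 0 := by
  have key : ∀ k, X ∈ degGE d κ k := by
    intro k
    induction k with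
    | zero => exact mem_degGE_zero _
    | succ k ih =>
      have hX : X = -((u - 1) * X) := by rw [sub_mul, h, one_mul, zero_sub, neg_neg]
      rw [hX]
      exact neg_mem (add_comm 1 k ▸ mul_mem_degGE hu ih)
  exact eq_zero_of_mem_degGE κ.lt_succ_self (key _)

/-! ### Differential calculus in the truncated tensor algebra -/

variable {S : Set ℝ} {t : ℝ}

/-- Multiplication in the truncated tensor algebra, as a continuous bilinear map. -/
def mulL (d κ : ℕ) : TruncTensor d κ →L[ℝ] TruncTensor d κ →L[ℝ] TruncTensor d κ :=
  LinearMap.toContinuousLinearMap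
    ((LinearMap.toContinuousLinearMap : (TruncTensor d κ →ₗ[ℝ] TruncTensor d κ) ≃ₗ[ℝ] _).toLinearMap
      ∘ₗ LinearMap.mul ℝ (TruncTensor d κ))

theorem mulL_apply (A B : TruncTensor d κ) : mulL d κ A B = A * B := rfl

theorem hasDerivWithinAt_mul {f g : ℝ → TruncTensor d κ} {f' g' : TruncTensor d κ}
    (hf : HasDerivWithinAt f f' S t) (hg : HasDerivWithinAt g g' S t) :
    HasDerivWithinAt (fun s => f s * g s) (f' * g t + f t * g') S t := by
  have := (mulL d κ).hasDerivWithinAt_of_bilinear hf hg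
  simpa [mulL_apply, add_comm] using this

theorem hasDerivWithinAt_pow {f : ℝ → TruncTensor d κ} {f' : TruncTensor d κ}
    (hf : HasDerivWithinAt f f' S t) (n : ℕ) :
    HasDerivWithinAt (fun s => f s ^ n)
      (∑ i ∈ Finset.range n, f t ^ i * f' * f t ^ (n - 1 - i)) S t := by
  induction n with
  | zero => simpa using hasDerivWithinAt_const t S (1 : TruncTensor d κ)
  | succ n ih =>
    have h := hasDerivWithinAt_mul ih hf
    simp only [← pow_succ] at h
    convert h using 1
    rw [Finset.sum_range_succ, Finset.sum_mul]
    congr 1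
    · refine Finset.sum_congr rfl fun i hi => ?_
      rw [Finset.mem_range] at hi
      rw [mul_assoc _ _ (f t), ← pow_succ]
      congr 2
      omega
    · simp

/-- A differentiable path stays in a subspace if it starts there and its velocity lies there. -/
theorem mem_of_hasDerivWithinAt_mem {H : Type*} [NormedAddCommGroup H] [NormedSpace ℝ H]
    [FiniteDimensional ℝ H] (N : Submodule ℝ H) {T : ℝ}
    {p p' : ℝ → H} (hp : ∀ t ∈ Icc 0 T, HasDerivWithinAt p (p' t) (Icc 0 T) t)
    (h0 : p 0 ∈ N) (hp' : ∀ t ∈ Icc 0 T, p' t ∈ N) : ∀ t ∈ Icc 0 T, p t ∈ N := by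
  intro t ht
  by_contra hcon
  obtain ⟨l, hl, hN⟩ := Submodule.exists_le_ker_of_notMem hcon
  have hN0 : ∀ x ∈ N, l x = 0 := fun x hx => LinearMap.mem_ker.1 (hN hx)
  let L : H →L[ℝ] ℝ := LinearMap.toContinuousLinearMap l
  have hd : ∀ s ∈ Icc 0 T, HasDerivWithinAt (fun s => L (p s)) 0 (Icc 0 T) s := by
    intro s hs
    have := L.hasFDerivAt.comp_hasDerivWithinAt s (hp s hs)
    have h2 : L (p' s) = 0 := hN0 _ (hp' s hs)
    rwa [h2] at this
  have := (convex_Icc (0 : ℝ) T).norm_image_sub_le_of_norm_hasDerivWithin_le (C := 0) hd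
    (by simp) (left_mem_Icc.2 (ht.1.trans ht.2)) ht
  simp only [zero_mul, norm_le_zero_iff, sub_eq_zero] at this
  exact hl (this.trans (hN0 _ h0))

/-- The velocity of a path in a subspace lies in the subspace. -/
theorem hasDerivWithinAt_mem {H : Type*} [NormedAddCommGroup H] [NormedSpace ℝ H]
    [FiniteDimensional ℝ H] (N : Submodule ℝ H) {T : ℝ} (hT : 0 < T)
    {p : ℝ → H} {p' : H} {t : ℝ} (ht : t ∈ Icc 0 T) (hp : HasDerivWithinAt p p' (Icc 0 T) t)
    (hN : ∀ t ∈ Icc 0 T, p t ∈ N) : p' ∈ N := by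
  by_contra hcon
  obtain ⟨l, hl, hN'⟩ := Submodule.exists_le_ker_of_notMem hcon
  have hN0 : ∀ x ∈ N, l x = 0 := fun x hx => LinearMap.mem_ker.1 (hN' hx)
  let L : H →L[ℝ] ℝ := LinearMap.toContinuousLinearMap l
  have h1 : HasDerivWithinAt (fun s => L (p s)) (L p') (Icc 0 T) t :=
    L.hasFDerivAt.comp_hasDerivWithinAt t hp
  have h2 : HasDerivWithinAt (fun s => L (p s)) 0 (Icc 0 T) t :=
    (hasDerivWithinAt_const t _ (0 : ℝ)).congr_of_mem (fun s hs => hN0 _ (hN s hs)) ht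
  exact hl ((uniqueDiffOn_Icc hT t ht).eq_deriv _ h1 h2)

/-- A path vanishes if it starts at zero and its velocity always has higher order than the path. -/
theorem eq_zero_of_deriv_order_lt {T : ℝ} {p p' : ℝ → TruncTensor d κ}
    (hp : ∀ t ∈ Icc 0 T, HasDerivWithinAt p (p' t) (Icc 0 T) t) (h0 : p 0 = 0)
    (h : ∀ k, ∀ t ∈ Icc 0 T, p t ∈ degGE d κ k → p' t ∈ degGE d κ (k + 1)) :
    ∀ t ∈ Icc 0 T, p t = 0 := by
  have key : ∀ k, ∀ t ∈ Icc 0 T, p t ∈ degGE d κ k := by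
    intro k
    induction k with
    | zero => exact fun t _ => mem_degGE_zero _
    | succ k ih =>
      exact mem_of_hasDerivWithinAt_mem _ hp (by rw [h0]; exact zero_mem _)
        fun t ht => h k t ht (ih t ht)
  exact fun t ht => eq_zero_of_mem_degGE κ.lt_succ_self (key _ t ht)

/-! ### The differential of the exponential map -/

/-- The series `∑ₖ (-1)ᵏ sᵏ⁺¹ / (k+1)! ad_c^k D`. For `s = 1` this is `(1 - e^{-ad c}) / ad c`
applied to `D`, the logarithmic derivative of the exponential map at `c` in the direction `D`. -/
def dexp (c D : TruncTensor d κ) (s : ℝ) : TruncTensor d κ :=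
  ∑ k ∈ Finset.range (κ + 1),
    ((-1 : ℝ) ^ k * s ^ (k + 1) / (k + 1).factorial) • ((LieAlgebra.ad ℝ (TruncTensor d κ) c) ^ k) D

theorem ad_pow_succ (c D : TruncTensor d κ) (k : ℕ) :
    ((LieAlgebra.ad ℝ (TruncTensor d κ) c) ^ (k + 1)) D
      = ⁅c, ((LieAlgebra.ad ℝ (TruncTensor d κ) c) ^ k) D⁆ := by
  rw [pow_succ', Module.End.mul_apply, LieAlgebra.ad_apply]

theorem ad_pow_mem_degGE {c D : TruncTensor d κ} (hc : c ∈ degGE d κ 1) (hD : D ∈ degGE d κ 1)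
    (k : ℕ) : ((LieAlgebra.ad ℝ (TruncTensor d κ) c) ^ k) D ∈ degGE d κ (k + 1) := by
  induction k with
  | zero => simpa using hD
  | succ k ih => rw [ad_pow_succ, add_comm]; exact lie_mem_degGE hc ih

theorem ad_pow_mem_lieSubalgebra (L : LieSubalgebra ℝ (TruncTensor d κ)) {c D : TruncTensor d κ}
    (hc : c ∈ L) (hD : D ∈ L) (k : ℕ) :
    ((LieAlgebra.ad ℝ (TruncTensor d κ) c) ^ k) D ∈ L := by
  induction k with
  | zero => simpa using hD
  | succ k ih => rw [ad_pow_succ]; exact L.lie_mem hc ih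

theorem dexp_mem_lieSubalgebra (L : LieSubalgebra ℝ (TruncTensor d κ)) {c D : TruncTensor d κ}
    (hc : c ∈ L) (hD : D ∈ L) (s : ℝ) : dexp c D s ∈ L :=
  L.toSubmodule.sum_mem fun k _ => L.smul_mem _ (ad_pow_mem_lieSubalgebra L hc hD k)

theorem dexp_zero (c D : TruncTensor d κ) : dexp c D 0 = 0 :=
  Finset.sum_eq_zero fun k _ => by simp

theorem dexp_of_lie_eq_zero {c D : TruncTensor d κ} (h : ⁅c, D⁆ = 0) : dexp c D 1 = D := by
  rw [dexp, Finset.sum_eq_single 0]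
  · simp
  · intro k _ hk
    obtain ⟨k, rfl⟩ := Nat.exists_eq_succ_of_ne_zero hk
    have : ((LieAlgebra.ad ℝ (TruncTensor d κ) c) ^ (k + 1)) D = 0 := by
      rw [pow_succ, Module.End.mul_apply, LieAlgebra.ad_apply, h, map_zero]
    rw [Nat.succ_eq_add_one, this, smul_zero]
  · simp

/-- `s ↦ dexp c D s` solves the linear equation `ζ' = D - [c, ζ]`. -/
theorem hasDerivAt_dexp {c D : TruncTensor d κ} (hc : c ∈ degGE d κ 1) (hD : D ∈ degGE d κ 1)
    (s : ℝ) : HasDerivAt (dexp c D) (D - ⁅c, dexp c D s⁆) s := by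
  have h : HasDerivAt (dexp c D) (∑ k ∈ Finset.range (κ + 1),
      ((-1 : ℝ) ^ k * (((k + 1 : ℕ) : ℝ) * s ^ k) / (k + 1).factorial) •
        ((LieAlgebra.ad ℝ (TruncTensor d κ) c) ^ k) D) s := by
    unfold dexp
    refine HasDerivAt.fun_sum fun k _ => ?_
    refine HasDerivAt.smul_const ?_ _
    have := ((hasDerivAt_pow (k + 1) s).const_mul ((-1 : ℝ) ^ k)).div_const
      ((k + 1).factorial : ℝ)
    simpa using this
  convert h using 1
  have hlast : ((LieAlgebra.ad ℝ (TruncTensor d κ) c) ^ (κ + 1)) D = 0 :=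
    eq_zero_of_mem_degGE (by omega) (ad_pow_mem_degGE hc hD (κ + 1))
  rw [Finset.sum_range_succ', dexp, lie_sum, Finset.sum_range_succ, lie_smul, ← ad_pow_succ, hlast,
    smul_zero, add_zero, sub_eq_neg_add, ← Finset.sum_neg_distrib]
  congr 1
  · refine Finset.sum_congr rfl fun k _ => ?_
    rw [lie_smul, ← ad_pow_succ, ← neg_smul]
    congr 1
    rw [Nat.factorial_succ (k + 1)]
    have : ((k + 1 : ℕ) : ℝ) + 1 ≠ 0 := by positivity
    have : ((k + 1).factorial : ℝ) ≠ 0 := by positivity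
    push_cast at *
    field_simp
    ring
  · simp

end TruncTensor

namespace TruncTensor

variable {d κ : ℕ} {S : Set ℝ} {t : ℝ}

/-- A sequence is determined by `r 0` and a recursion `(k + 1) r (k + 1) = r k * c + b k`. -/
theorem eq_of_recursion {c : TruncTensor d κ} {b u w : ℕ → TruncTensor d κ} (h0 : u 0 = w 0)
    (hu : ∀ k : ℕ, ((k : ℝ) + 1) • u (k + 1) = u k * c + b k)
    (hw : ∀ k : ℕ, ((k : ℝ) + 1) • w (k + 1) = w k * c + b k) (k : ℕ) : u k = w k := by
  induction k with
  | zero => exact h0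
  | succ k ih =>
    have hk : (k : ℝ) + 1 ≠ 0 := by positivity
    exact smul_right_injective _ hk ((hu k).trans ((congrArg (· * c + b k) ih).trans (hw k).symm))

/-- The coefficient of `sᵏ` in the directional derivative of `c ↦ exp (s c)`, computed as a product
of the exponential series with the series of `dexp`. Both sides satisfy the recursion which
expresses that `∂ₛ(∂_D e^{sc}) = (∂_D e^{sc}) c + e^{sc} D`. -/
theorem sum_pow_mul_mul_pow_eq (c D : TruncTensor d κ) (k : ℕ) :
    ((k.factorial : ℝ)⁻¹) • ∑ i ∈ Finset.range k, c ^ i * D * c ^ (k - 1 - i)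
      = ∑ p ∈ Finset.HasAntidiagonal.antidiagonal k, ((p.1.factorial : ℝ)⁻¹ • c ^ p.1) *
          (if p.2 = 0 then 0 else ((-1 : ℝ) ^ (p.2 - 1) / p.2.factorial) •
            ((LieAlgebra.ad ℝ (TruncTensor d κ) c) ^ (p.2 - 1)) D) := by
  set z : ℕ → TruncTensor d κ := fun j => if j = 0 then 0 else ((-1 : ℝ) ^ (j - 1) / j.factorial) •
            ((LieAlgebra.ad ℝ (TruncTensor d κ) c) ^ (j - 1)) D with hz
  set e : ℕ → TruncTensor d κ := fun i => (i.factorial : ℝ)⁻¹ • c ^ i with he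
  have he' (i : ℕ) : ((i : ℝ) + 1) • e (i + 1) = e i * c := by
    simp only [he, smul_smul, smul_mul_assoc, ← pow_succ]
    congr 1
    rw [Nat.factorial_succ]
    have : (i.factorial : ℝ) ≠ 0 := by positivity
    have : (i : ℝ) + 1 ≠ 0 := by positivity
    push_cast
    field_simp
  have hz' (j : ℕ) : ((j : ℝ) + 1) • z (j + 1) + (c * z j - z j * c) = if j = 0 then D else 0 := by
    rcases Nat.eq_zero_or_pos j with rfl | hj
    · simp [hz]
    · obtain ⟨j, rfl⟩ := Nat.exists_eq_succ_of_ne_zero hj.ne'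
      rw [← LieRing.of_associative_ring_bracket]
      simp only [hz, Nat.succ_eq_add_one, Nat.add_sub_cancel, Nat.succ_ne_zero, if_false, lie_smul,
        ← ad_pow_succ, smul_smul, ← add_smul]
      convert zero_smul ℝ _
      rw [Nat.factorial_succ (j + 1)]
      have : ((j + 1).factorial : ℝ) ≠ 0 := by positivity
      have : ((j : ℝ) + 1 + 1) ≠ 0 := by positivity
      push_cast
      field_simp
      ring
  refine eq_of_recursion (c := c) (b := fun k => e k * D)
    (u := fun k => ((k.factorial : ℝ)⁻¹) • ∑ i ∈ Finset.range k, c ^ i * D * c ^ (k - 1 - i))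
    (w := fun k => ∑ p ∈ Finset.HasAntidiagonal.antidiagonal k, e p.1 * z p.2) ?_ ?_ ?_ k
  · simp [hz]
  · intro k
    have hk : (k : ℝ) + 1 ≠ 0 := by positivity
    have hk' : (k.factorial : ℝ) ≠ 0 := by positivity
    have h1 : ((k : ℝ) + 1) * ((k + 1).factorial : ℝ)⁻¹ = (k.factorial : ℝ)⁻¹ := by
      rw [Nat.factorial_succ]; push_cast; field_simp
    simp only [smul_smul, h1, he, smul_mul_assoc, ← smul_add]
    congr 1
    rw [Finset.sum_range_succ, Finset.sum_mul]
    congr 1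
    · refine Finset.sum_congr rfl fun i hi => ?_
      rw [Finset.mem_range] at hi
      rw [mul_assoc _ _ c, ← pow_succ]
      congr 2
      omega
    · simp
  · intro k
    have h1 : ((k : ℝ) + 1) • ∑ p ∈ Finset.HasAntidiagonal.antidiagonal (k + 1), e p.1 * z p.2
        = ∑ p ∈ Finset.HasAntidiagonal.antidiagonal (k + 1), ((p.1 : ℝ) • e p.1) * z p.2
          + ∑ p ∈ Finset.HasAntidiagonal.antidiagonal (k + 1), e p.1 * ((p.2 : ℝ) • z p.2) := by
      rw [Finset.smul_sum, ← Finset.sum_add_distrib]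
      refine Finset.sum_congr rfl fun p hp => ?_
      rw [smul_mul_assoc (p.1 : ℝ), mul_smul_comm, ← add_smul]
      congr 1
      exact_mod_cast (Finset.HasAntidiagonal.mem_antidiagonal.1 hp).symm
    rw [h1, Finset.Nat.sum_antidiagonal_succ, Finset.Nat.sum_antidiagonal_succ']
    simp only [Nat.cast_zero, zero_smul, zero_mul, zero_add, mul_zero, Nat.cast_add, Nat.cast_one,
      he', Finset.sum_mul]
    rw [← Finset.sum_add_distrib]
    have h2 : e k * D = ∑ p ∈ Finset.HasAntidiagonal.antidiagonal k,
        e p.1 * (if p.2 = 0 then D else 0) := by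
      rw [Finset.sum_eq_single (k, 0)]
      · simp
      · rintro ⟨i, j⟩ hp hne
        have : j ≠ 0 := by
          rintro rfl
          simp at hp
          exact hne (by rw [hp])
        simp [this]
      · simp
    rw [h2, ← Finset.sum_add_distrib]
    refine Finset.sum_congr rfl fun p _ => ?_
    rw [← hz' p.2]
    noncomm_ring

/-- The derivative of the exponential in direction `D` is `exp c * dexp c D 1`. -/
theorem sum_exp_deriv_eq {c D : TruncTensor d κ} (hc : c ∈ degGE d κ 1) (hD : D ∈ degGE d κ 1) :
    ∑ k ∈ Finset.range (κ + 1),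
        ((k.factorial : ℝ)⁻¹) • ∑ i ∈ Finset.range k, c ^ i * D * c ^ (k - 1 - i)
      = exp c * dexp c D 1 := by
  have hz (j : ℕ) : (if j = 0 then 0 else ((-1 : ℝ) ^ (j - 1) / j.factorial) •
      ((LieAlgebra.ad ℝ (TruncTensor d κ) c) ^ (j - 1)) D) ∈ degGE d κ j := by
    split_ifs with hj
    · exact zero_mem _
    · have := ad_pow_mem_degGE hc hD (j - 1)
      rw [Nat.sub_add_cancel (Nat.pos_of_ne_zero hj)] at this
      exact Submodule.smul_mem _ _ this
  have hdexp : dexp c D 1 = ∑ j ∈ Finset.range (κ + 1),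
      (if j = 0 then 0 else ((-1 : ℝ) ^ (j - 1) / j.factorial) •
        ((LieAlgebra.ad ℝ (TruncTensor d κ) c) ^ (j - 1)) D) := by
    have h := Finset.sum_range_succ (fun j => if j = 0 then 0 else
      ((-1 : ℝ) ^ (j - 1) / j.factorial) •
        ((LieAlgebra.ad ℝ (TruncTensor d κ) c) ^ (j - 1)) D) (κ + 1)
    rw [eq_zero_of_mem_degGE κ.lt_succ_self (hz (κ + 1)), add_zero] at h
    rw [← h, Finset.sum_range_succ']
    simp [dexp]
  simp only [sum_pow_mul_mul_pow_eq]
  rw [hdexp, exp, Finset.sum_mul_sum]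
  simp only [Finset.Nat.sum_antidiagonal_eq_sum_range_succ_mk]
  rw [Finset.sum_range_diag_flip (κ + 1) fun i j => ((i.factorial : ℝ)⁻¹ • c ^ i) *
          (if j = 0 then 0 else ((-1 : ℝ) ^ (j - 1) / j.factorial) •
            ((LieAlgebra.ad ℝ (TruncTensor d κ) c) ^ (j - 1)) D)]
  refine Finset.sum_congr rfl fun i hi => ?_
  refine Finset.sum_subset (Finset.range_subset_range.2 (Nat.sub_le _ _)) fun j _ hj => ?_
  rw [Finset.mem_range] at hi hj
  refine eq_zero_of_mem_degGE (k := i + j) (by omega) (mul_mem_degGE ?_ (hz j))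
  exact Submodule.smul_mem _ _ (pow_mem_degGE hc i)

theorem hasDerivWithinAt_exp {c : ℝ → TruncTensor d κ} {c' : TruncTensor d κ}
    (hc : HasDerivWithinAt c c' S t) (hct : c t ∈ degGE d κ 1) (hc' : c' ∈ degGE d κ 1) :
    HasDerivWithinAt (fun s => exp (c s)) (exp (c t) * dexp (c t) c' 1) S t := by
  rw [← sum_exp_deriv_eq hct hc']
  unfold exp
  exact HasDerivWithinAt.fun_sum fun k _ => (hasDerivWithinAt_pow hc k).fun_const_smul _

theorem hasDerivWithinAt_exp_smul {A : TruncTensor d κ} (hA : A ∈ degGE d κ 1) :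
    HasDerivWithinAt (fun s : ℝ => exp (s • A)) (exp (t • A) * A) S t := by
  have h := hasDerivWithinAt_exp (S := S) (t := t) (c := fun s : ℝ => s • A) (c' := A)
    (by simpa using (hasDerivWithinAt_id t S).smul_const A) (Submodule.smul_mem _ _ hA) hA
  rwa [dexp_of_lie_eq_zero (by simp)] at h

/-- The logarithm of a differentiable unipotent path is differentiable. -/
theorem exists_hasDerivWithinAt_log {g : ℝ → TruncTensor d κ} {g' : TruncTensor d κ}
    (hg : HasDerivWithinAt g g' S t) (hg' : g' ∈ degGE d κ 1) :
    ∃ c' ∈ degGE d κ 1, HasDerivWithinAt (fun s => log (g s)) c' S t := by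
  refine ⟨_, ?_, HasDerivWithinAt.fun_sum fun k _ =>
    (hasDerivWithinAt_pow (hg.sub_const 1) k).fun_const_smul _⟩
  refine Submodule.sum_mem _ fun k _ => Submodule.smul_mem _ _ <| Submodule.sum_mem _ fun i _ => ?_
  exact mul_mem_degGE_right _ (mul_mem_degGE_left _ hg')

/-! ### Exponential and logarithm are inverse to each other -/

/-- The path `s ↦ exp (log (1 + s x))` and the path `s ↦ 1 + s x` solve the same linear equation
`p' = p L'`, where `L s = log (1 + s x)`. -/
theorem exp_log {g : TruncTensor d κ} (hg : g - 1 ∈ degGE d κ 1) : exp (log g) = g := by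
  obtain ⟨x, rfl⟩ : ∃ x, g = 1 + x := ⟨g - 1, by abel⟩
  rw [add_sub_cancel_left] at hg
  let L : ℝ → TruncTensor d κ := fun s => log (1 + s • x)
  let L' : ℝ → TruncTensor d κ := fun s =>
    ∑ k ∈ Finset.Icc 1 κ, ((-1 : ℝ) ^ (k + 1) * s ^ (k - 1)) • x ^ k
  have hLsum (s : ℝ) : L s = ∑ k ∈ Finset.Icc 1 κ, ((-1 : ℝ) ^ (k + 1) / k * s ^ k) • x ^ k := by
    refine Finset.sum_congr rfl fun k _ => ?_
    rw [add_sub_cancel_left, smul_pow, smul_smul]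
  have hL (s : ℝ) : HasDerivWithinAt L (L' s) (Icc 0 1) s := by
    rw [funext hLsum]
    refine HasDerivWithinAt.fun_sum fun k hk => HasDerivWithinAt.smul_const ?_ _
    have hk0 : (k : ℝ) ≠ 0 := by
      have := (Finset.mem_Icc.1 hk).1
      positivity
    convert ((hasDerivAt_pow k s).hasDerivWithinAt (s := Icc 0 1)).const_mul
      ((-1 : ℝ) ^ (k + 1) / k) using 1
    field_simp
  have hL1 (s : ℝ) : L s ∈ degGE d κ 1 := log_mem (by
    rw [add_sub_cancel_left]; exact Submodule.smul_mem _ _ hg)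
  have hL'1 (s : ℝ) : L' s ∈ degGE d κ 1 := Submodule.sum_mem _ fun k hk =>
    Submodule.smul_mem _ _ (pow_mem_degGE_one hg (by have := (Finset.mem_Icc.1 hk).1; omega))
  have hcomm (s : ℝ) : ⁅L s, L' s⁆ = 0 := by
    rw [← commute_iff_lie_eq, hLsum]
    refine Commute.sum_left _ _ _ fun i _ => Commute.sum_right _ _ _ fun j _ => ?_
    exact ((Commute.pow_pow_self x i j).smul_left _).smul_right _
  -- the telescoping identity `(1 + s x) L' = x`
  have hxL (s : ℝ) : (1 + s • x) * L' s = x := by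
    have key : ∀ n : ℕ, (1 + s • x) *
        ∑ k ∈ Finset.Icc 1 n, ((-1 : ℝ) ^ (k + 1) * s ^ (k - 1)) • x ^ k
          = x - ((-1 : ℝ) ^ n * s ^ n) • x ^ (n + 1) := by
      intro n
      induction n with
      | zero => simp
      | succ n ih =>
        rw [Finset.sum_Icc_succ_top (by omega), mul_add, ih, Nat.add_sub_cancel, add_mul, one_mul,
          smul_mul_smul_comm, ← pow_succ', sub_add, ← sub_sub]
        have h1 : (-1 : ℝ) ^ (n + 1 + 1) * s ^ n = (-1) ^ n * s ^ n := by ring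
        have h2 : s * ((-1 : ℝ) ^ (n + 1 + 1) * s ^ n) = -((-1) ^ (n + 1) * s ^ (n + 1)) := by ring
        rw [h1, sub_self, ← h1, h2, neg_smul, sub_neg_eq_add, zero_add]
    have := key κ
    rwa [pow_eq_zero hg κ.lt_succ_self, smul_zero, sub_zero] at this
  have hp : ∀ s ∈ Icc (0 : ℝ) 1, HasDerivWithinAt (fun s => exp (L s) - (1 + s • x))
      ((exp (L s) - (1 + s • x)) * L' s) (Icc 0 1) s := by
    intro s _
    have h1 := hasDerivWithinAt_exp (hL s) (hL1 s) (hL'1 s)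
    rw [dexp_of_lie_eq_zero (hcomm s)] at h1
    have h2 : HasDerivWithinAt (fun s : ℝ => 1 + s • x) x (Icc 0 1) s := by
      simpa using ((hasDerivWithinAt_id s (Icc 0 1)).smul_const x).const_add 1
    rw [sub_mul, hxL]
    exact h1.sub h2
  have := eq_zero_of_deriv_order_lt hp (by simp [L, log_one, exp_zero])
    (fun k s _ hk => mul_mem_degGE hk (hL'1 s)) 1 (by simp)
  simpa [L, sub_eq_zero] using this

end TruncTensor

namespace TruncTensor

variable {d κ : ℕ}

/-! ### Logarithms of solutions of `g' = g b` -/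

/-- For `k ≥ 1`, the bracket of two elements of `L + degGE k` lies in `L + degGE (k + 1)`, because
the elements of the Lie subalgebra `L` have no component of degree zero. -/
theorem lie_mem_sup_degGE {L : LieSubalgebra ℝ (TruncTensor d κ)} (hL : L ≤ augmentation d κ)
    {k : ℕ} (hk : 1 ≤ k) {A B : TruncTensor d κ} (hA : A ∈ L.toSubmodule ⊔ degGE d κ k)
    (hB : B ∈ L.toSubmodule ⊔ degGE d κ k) : ⁅A, B⁆ ∈ L.toSubmodule ⊔ degGE d κ (k + 1) := by
  obtain ⟨a, ha, i, hi, rfl⟩ := Submodule.mem_sup.1 hA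
  obtain ⟨b, hb, j, hj, rfl⟩ := Submodule.mem_sup.1 hB
  have ha1 : a ∈ degGE d κ 1 := hL ha
  have hb1 : b ∈ degGE d κ 1 := hL hb
  refine Submodule.mem_sup.2 ⟨⁅a, b⁆, L.lie_mem ha hb, ⁅a, j⁆ + ⁅i, b⁆ + ⁅i, j⁆, ?_, ?_⟩
  · refine add_mem (add_mem ?_ (lie_mem_degGE hi hb1)) ?_
    · exact add_comm 1 k ▸ lie_mem_degGE ha1 hj
    · exact degGE_mono (by omega) (lie_mem_degGE hi hj)
  · simp only [add_lie, lie_add]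
    abel

/-- If `g' = g b` with `b` in a Lie algebra `L` of tensors without component of degree zero, and if
`log g` starts in `L`, then `c = log g` stays in `L`, has a derivative `c'` in `L`, and the
differential of the exponential maps `c'` to `b`. The containment in `L` is proved modulo tensors of
higher and higher degree: `c' = b + ½ [c, c'] - …`, where the brackets gain a degree. -/
theorem exists_hasDerivWithinAt_log_of_development {L : LieSubalgebra ℝ (TruncTensor d κ)}
    (hL : L ≤ augmentation d κ) {T : ℝ} (hT : 0 < T) {g b : ℝ → TruncTensor d κ}
    (hg : ∀ t ∈ Icc 0 T, HasDerivWithinAt g (g t * b t) (Icc 0 T) t)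
    (hg1 : ∀ t ∈ Icc 0 T, g t - 1 ∈ degGE d κ 1) (hb : ∀ t ∈ Icc 0 T, b t ∈ L)
    (h0 : log (g 0) ∈ L) :
    ∃ c' : ℝ → TruncTensor d κ, ∀ t ∈ Icc 0 T, log (g t) ∈ L ∧ c' t ∈ L ∧
      HasDerivWithinAt (fun s => log (g s)) (c' t) (Icc 0 T) t ∧
      dexp (log (g t)) (c' t) 1 = b t := by
  have hb1 : ∀ t ∈ Icc 0 T, b t ∈ degGE d κ 1 := fun t ht => hL (hb t ht)
  have hex : ∀ t, ∃ c' : TruncTensor d κ, t ∈ Icc 0 T → c' ∈ degGE d κ 1 ∧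
      HasDerivWithinAt (fun s => log (g s)) c' (Icc 0 T) t := by
    intro t
    by_cases ht : t ∈ Icc 0 T
    · obtain ⟨c', h1, h2⟩ := exists_hasDerivWithinAt_log (hg t ht)
        (mul_mem_degGE_left _ (hb1 t ht))
      exact ⟨c', fun _ => ⟨h1, h2⟩⟩
    · exact ⟨0, fun h => absurd h ht⟩
  choose c' hc' using hex
  have hc1 : ∀ t ∈ Icc 0 T, log (g t) ∈ degGE d κ 1 := fun t ht => log_mem (hg1 t ht)
  have hdexp : ∀ t ∈ Icc 0 T, dexp (log (g t)) (c' t) 1 = b t := by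
    intro t ht
    have h1 := hasDerivWithinAt_exp (hc' t ht).2 (hc1 t ht) (hc' t ht).1
    have h2 : HasDerivWithinAt (fun s => exp (log (g s))) (g t * b t) (Icc 0 T) t :=
      (hg t ht).congr_of_mem (fun s hs => exp_log (hg1 s hs)) ht
    have h3 := (uniqueDiffOn_Icc hT t ht).eq_deriv _ h1 h2
    rw [exp_log (hg1 t ht)] at h3
    refine sub_eq_zero.1 (eq_zero_of_unipotent_mul (hg1 t ht) ?_)
    rw [mul_sub, h3, sub_self]
  have hstep : ∀ k, ∀ t ∈ Icc 0 T, log (g t) ∈ L.toSubmodule ⊔ degGE d κ (k + 1) := by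
    intro k
    induction k with
    | zero => exact fun t ht => Submodule.mem_sup_right (hc1 t ht)
    | succ k ih =>
      refine mem_of_hasDerivWithinAt_mem _ (fun t ht => (hc' t ht).2) (Submodule.mem_sup_left h0) ?_
      intro t ht
      have h' := hasDerivWithinAt_mem _ hT ht (hc' t ht).2 ih
      -- all terms of `dexp` except the first one are iterated brackets
      have hsum := hdexp t ht
      rw [dexp, Finset.sum_range_succ'] at hsum
      simp only [one_pow, mul_one, pow_zero, zero_add, Nat.factorial_one, Nat.cast_one, div_one,
        one_smul, Module.End.one_apply] at hsum
      rw [← eq_sub_iff_add_eq'] at hsum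
      rw [hsum]
      refine sub_mem (Submodule.mem_sup_left (hb t ht)) (Submodule.sum_mem _ fun j hj =>
        Submodule.smul_mem _ _ ?_)
      clear hj
      have hle : L.toSubmodule ⊔ degGE d κ (k + 1 + 1) ≤ L.toSubmodule ⊔ degGE d κ (k + 1) :=
        sup_le_sup_left (degGE_mono (by omega)) _
      induction j with
      | zero =>
        rw [ad_pow_succ]
        exact lie_mem_sup_degGE hL (by omega) (ih t ht) (by simpa using h')
      | succ j ihj =>
        rw [ad_pow_succ]
        exact lie_mem_sup_degGE hL (by omega) (ih t ht) (hle ihj)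
  have hmem : ∀ t ∈ Icc 0 T, log (g t) ∈ L := by
    intro t ht
    obtain ⟨a, ha, i, hi, h⟩ := Submodule.mem_sup.1 (hstep κ t ht)
    rw [eq_zero_of_mem_degGE κ.lt_succ_self hi, add_zero] at h
    exact h ▸ ha
  exact ⟨c', fun t ht => ⟨hmem t ht, hasDerivWithinAt_mem L.toSubmodule hT ht (hc' t ht).2 hmem,
    (hc' t ht).2, hdexp t ht⟩⟩

/-- The logarithm of `s ↦ exp (s A)` stays on the line through `A`, where all brackets vanish. -/
theorem log_exp {A : TruncTensor d κ} (hA : A ∈ degGE d κ 1) : log (exp A) = A := by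
  let L : LieSubalgebra ℝ (TruncTensor d κ) :=
    { Submodule.span ℝ {A} with
      lie_mem' := by
        intro x y hx hy
        obtain ⟨a, rfl⟩ := Submodule.mem_span_singleton.1 hx
        obtain ⟨b, rfl⟩ := Submodule.mem_span_singleton.1 hy
        simp }
  have hAL : A ∈ L := Submodule.mem_span_singleton_self A
  have hL : L ≤ augmentation d κ := by
    intro x hx
    obtain ⟨a, rfl⟩ := Submodule.mem_span_singleton.1 hx
    exact Submodule.smul_mem _ _ hA
  obtain ⟨c', hc'⟩ := exists_hasDerivWithinAt_log_of_development hL one_pos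
    (g := fun s : ℝ => exp (s • A)) (b := fun _ => A)
    (fun t _ => hasDerivWithinAt_exp_smul hA)
    (fun t _ => exp_sub_one_mem (Submodule.smul_mem _ _ hA)) (fun _ _ => hAL)
    (by simp only [zero_smul, exp_zero, log_one]; exact zero_mem L)
  have key := eq_zero_of_deriv_order_lt (T := 1) (p := fun s : ℝ => log (exp (s • A)) - s • A)
    (p' := fun _ => 0) ?_ (by simp [exp_zero, log_one]) (fun _ _ _ _ => zero_mem _) 1 (by simp)
  · simpa [sub_eq_zero] using key
  · intro t ht
    obtain ⟨h1, h2, h3, h4⟩ := hc' t ht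
    have hlie : ⁅log (exp (t • A)), c' t⁆ = 0 := by
      obtain ⟨a, ha⟩ := Submodule.mem_span_singleton.1 h1
      obtain ⟨b, hb⟩ := Submodule.mem_span_singleton.1 h2
      rw [← ha, ← hb]
      simp
    rw [dexp_of_lie_eq_zero hlie] at h4
    have := h3.sub ((hasDerivWithinAt_id t (Icc 0 1)).smul_const A)
    rw [h4, one_smul, sub_self] at this
    exact this

/-! ### Existence of the development -/

theorem intervalIntegral_mem {H : Type*} [NormedAddCommGroup H] [NormedSpace ℝ H]
    [FiniteDimensional ℝ H] (N : Submodule ℝ H) {f : ℝ → H} (hf : Continuous f)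
    (hN : ∀ s, f s ∈ N) (t : ℝ) : ∫ s in (0 : ℝ)..t, f s ∈ N := by
  have := FiniteDimensional.complete ℝ H
  by_contra hcon
  obtain ⟨l, hl, hker⟩ := Submodule.exists_le_ker_of_notMem hcon
  let L : H →L[ℝ] ℝ := LinearMap.toContinuousLinearMap l
  refine hl ?_
  have h := L.intervalIntegral_comp_comm (hf.intervalIntegrable (μ := MeasureTheory.volume) 0 t)
  have h0 (s : ℝ) : L (f s) = 0 := LinearMap.mem_ker.1 (hker (hN s))
  simp only [h0, intervalIntegral.integral_zero] at h
  exact h.symm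

/-- Picard iteration for `g' = g b` becomes stationary after `κ` steps. -/
theorem exists_development {b : ℝ → TruncTensor d κ} (hb : Continuous b)
    (hb1 : ∀ t, b t ∈ degGE d κ 1) :
    ∃ g : ℝ → TruncTensor d κ, g 0 = 1 ∧ (∀ t, HasDerivAt g (g t * b t) t) := by
  have hmul : Continuous fun p : TruncTensor d κ × TruncTensor d κ => p.1 * p.2 := by
    have : Continuous fun p : TruncTensor d κ × TruncTensor d κ => mulL d κ p.1 p.2 := by fun_prop
    exact this
  let P : ℕ → ℝ → TruncTensor d κ := fun n => Nat.rec (fun _ => 1)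
    (fun _ g t => 1 + ∫ s in (0 : ℝ)..t, g s * b s) n
  have hPs (n : ℕ) (t : ℝ) : P (n + 1) t = 1 + ∫ s in (0 : ℝ)..t, P n s * b s := rfl
  have hder (g : ℝ → TruncTensor d κ) (hg : Continuous g) (t : ℝ) :
      HasDerivAt (fun t => 1 + ∫ s in (0 : ℝ)..t, g s * b s) (g t * b t) t := by
    have hc : Continuous fun s => g s * b s := hmul.comp (hg.prodMk hb)
    exact (intervalIntegral.integral_hasDerivAt_right (hc.intervalIntegrable _ _)
      (hc.stronglyMeasurableAtFilter _ _) hc.continuousAt).const_add 1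
  have hcont (n : ℕ) : Continuous (P n) := by
    induction n with
    | zero => exact continuous_const
    | succ n ih => exact continuous_iff_continuousAt.2 fun t => (hder _ ih t).continuousAt
  have hdiff (n : ℕ) (t : ℝ) : P (n + 1) t - P n t ∈ degGE d κ (n + 1) := by
    induction n generalizing t with
    | zero =>
      have h0 (s : ℝ) : P 0 s = 1 := rfl
      simp only [hPs, h0, add_sub_cancel_left, one_mul]
      exact intervalIntegral_mem _ hb hb1 t
    | succ n ih =>
      have hc (k : ℕ) : Continuous fun s => P k s * b s := hmul.comp ((hcont k).prodMk hb)
      have hmem := intervalIntegral_mem (degGE d κ (n + 1 + 1)) ((hc (n + 1)).sub (hc n))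
        (fun s => by
          have := mul_mem_degGE (ih s) (hb1 s)
          rwa [sub_mul] at this) t
      have hsub := intervalIntegral.integral_sub
        ((hc (n + 1)).intervalIntegrable (μ := MeasureTheory.volume) 0 t)
        ((hc n).intervalIntegrable 0 t)
      rw [hPs (n + 1), hPs n, add_sub_add_left_eq_sub]
      exact hsub ▸ hmem
  refine ⟨P κ, ?_, fun t => ?_⟩
  · cases κ <;> simp [P]
  · have h : P (κ + 1) = P κ := funext fun t =>
      sub_eq_zero.1 (eq_zero_of_mem_degGE κ.lt_succ_self (hdiff κ t))
    have := hder _ (hcont κ) t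
    rwa [show (fun t => 1 + ∫ s in (0 : ℝ)..t, P κ s * b s) = P κ from h] at this

end TruncTensor

namespace TruncTensor

variable {d κ : ℕ}

/-! ### The extension of a nilpotent system is a Lie homomorphism -/

/-- The right-normed bracket `[a₁, [a₂, … [aₖ, a₀]]]`. -/
def rightNormed {L : Type*} [LieRing L] (a₀ : L) : List L → L
  | [] => a₀
  | a :: l => ⁅a, rightNormed a₀ l⁆

theorem rightNormed_eq_zero_of_le {L ι : Type*} [LieRing L] {n : ℕ} {v : ι → L}
    (h : ∀ (a₀ : ι) (l : List ι), l.length = n → rightNormed (v a₀) (l.map v) = 0) (a₀ : ι)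
    (l : List ι) (hl : n ≤ l.length) : rightNormed (v a₀) (l.map v) = 0 := by
  induction l with
  | nil => exact h _ _ (by simp at hl ⊢; omega)
  | cons a l ih =>
    rcases hl.eq_or_lt with h' | h'
    · exact h _ _ h'.symm
    · rw [List.map_cons, rightNormed, ih (by simpa [Nat.lt_succ_iff] using h'), lie_zero]

/-- A Lie subalgebra is spanned by the right-normed brackets of a generating family. -/
theorem lieSpan_le_span_rightNormed {L ι : Type*} [LieRing L] [LieAlgebra ℝ L] (v : ι → L)
    {x : L} (hx : x ∈ LieSubalgebra.lieSpan ℝ L (Set.range v)) :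
    x ∈ Submodule.span ℝ
      (Set.range fun p : ι × List ι => rightNormed (v p.1) (p.2.map v)) := by
  set N := Submodule.span ℝ (Set.range fun p : ι × List ι => rightNormed (v p.1) (p.2.map v))
    with hN
  have hlie : ∀ x ∈ LieSubalgebra.lieSpan ℝ L (Set.range v), ∀ y ∈ N, ⁅x, y⁆ ∈ N := by
    intro x hx
    induction hx using LieSubalgebra.lieSpan_induction with
    | mem x hx =>
      obtain ⟨a, rfl⟩ := hx
      intro y hy
      induction hy using Submodule.span_induction with
      | mem y hy =>
        obtain ⟨⟨a₀, l⟩, rfl⟩ := hy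
        exact Submodule.subset_span ⟨(a₀, a :: l), rfl⟩
      | zero => rw [lie_zero]; exact zero_mem _
      | add y z _ _ hy hz => rw [lie_add]; exact add_mem hy hz
      | smul c y _ hy => rw [lie_smul]; exact Submodule.smul_mem _ _ hy
    | zero => intro y _; rw [zero_lie]; exact zero_mem _
    | add x y _ _ hx hy => intro z hz; rw [add_lie]; exact add_mem (hx z hz) (hy z hz)
    | smul c x _ hx => intro z hz; rw [smul_lie]; exact Submodule.smul_mem _ _ (hx z hz)
    | lie x y _ _ hx hy =>
      intro z hz
      rw [lie_lie]
      exact sub_mem (hx _ (hy z hz)) (hy _ (hx z hz))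
  induction hx using LieSubalgebra.lieSpan_induction with
  | mem x hx =>
    obtain ⟨a, rfl⟩ := hx
    exact Submodule.subset_span ⟨(a, []), rfl⟩
  | zero => exact zero_mem _
  | add x y _ _ hx hy => exact add_mem hx hy
  | smul c x _ hx => exact Submodule.smul_mem _ _ hx
  | lie x y hx _ _ hy => exact hlie x hx y hy

/-- The monomial of the tensor algebra labelled by a word. -/
def monomial {d : ℕ} (w : List (Fin d)) : TensorAlgebra ℝ (Fin d → ℝ) :=
  (w.map fun i => TensorAlgebra.ι ℝ (Pi.single i (1 : ℝ) : Fin d → ℝ)).prod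

theorem toTensor_eq (A : TruncTensor d κ) : A.toTensor = ∑ w : Word d κ, A w • monomial w.1 := rfl

/-- The inclusion of the truncated tensor algebra into the tensor algebra as a linear map. -/
def toTensorₗ (d κ : ℕ) : TruncTensor d κ →ₗ[ℝ] TensorAlgebra ℝ (Fin d → ℝ) where
  toFun := toTensor
  map_add' A B := by simp [toTensor_eq, add_smul, Finset.sum_add_distrib]
  map_smul' c A := by simp [toTensor_eq, mul_smul, Finset.smul_sum]

theorem toTensorₗ_apply (A : TruncTensor d κ) : toTensorₗ d κ A = A.toTensor := rfl

/-- The inclusion into the tensor algebra respects products which are not truncated. -/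
theorem toTensor_mul {i j : ℕ} (hij : i + j ≤ κ) {A B : TruncTensor d κ}
    (hA : ∀ w : Word d κ, i < w.1.length → A w = 0)
    (hB : ∀ w : Word d κ, j < w.1.length → B w = 0) :
    (A * B).toTensor = A.toTensor * B.toTensor := by
  simp only [toTensor_eq, mul_apply, Finset.sum_smul, Finset.sum_mul_sum, smul_mul_smul_comm]
  rw [Finset.sum_sigma', ← Finset.sum_product' (f := fun u v : Word d κ =>
    (A u * B v) • (monomial u.1 * monomial v.1))]
  refine Finset.sum_of_injOn (fun p => (p.1.take p.2, p.1.drop p.2)) ?_ (fun _ _ => by simp) ?_ ?_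
  · rintro ⟨w, m⟩ hm ⟨w', m'⟩ hm' h
    simp only [Finset.coe_sigma, Set.mem_sigma_iff, Finset.coe_univ, Set.mem_univ, true_and,
      Finset.coe_range, Set.mem_Iio, Prod.mk.injEq, Word.take, Word.drop, Subtype.mk.injEq]
      at hm hm' h
    have hw : w = w' := Subtype.ext <| by
      rw [← List.take_append_drop m w.1, h.1, h.2, List.take_append_drop]
    subst hw
    have := congrArg List.length h.1
    simp only [List.length_take] at this
    have : m = m' := by omega
    rw [this]
  · rintro ⟨u, v⟩ _ huv
    by_cases hu : i < u.1.length
    · rw [hA u hu, zero_mul, zero_smul]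
    by_cases hv : j < v.1.length
    · rw [hB v hv, mul_zero, zero_smul]
    refine absurd ?_ huv
    refine ⟨⟨⟨u.1 ++ v.1, by simp; omega⟩, u.1.length⟩, by simp, ?_⟩
    simp [Word.take, Word.drop]
  · rintro ⟨w, m⟩ _
    have : monomial w.1 = monomial (w.take m).1 * monomial (w.drop m).1 := by
      rw [monomial, monomial, monomial, ← List.prod_append, ← List.map_append, Word.take, Word.drop,
        List.take_append_drop]
    rw [this]

theorem ofVec_apply_of_length_ne {a : Fin d → ℝ} {w : Word d κ} (hw : w.1.length ≠ 1) :
    ofVec d κ a w = 0 := by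
  refine Finset.sum_eq_zero fun i _ => if_neg fun h => hw ?_
  rw [h, List.length_singleton]

theorem ofVec_mem_freeNilpotent (a : Fin d → ℝ) : ofVec d κ a ∈ freeNilpotent d κ :=
  LieSubalgebra.subset_lieSpan ⟨a, rfl⟩

theorem toTensor_ofVec (hκ : 1 ≤ κ) (a : Fin d → ℝ) :
    (ofVec d κ a).toTensor = TensorAlgebra.ι ℝ a := by
  have ha : TensorAlgebra.ι ℝ a =
      ∑ i, a i • TensorAlgebra.ι ℝ (Pi.single i (1 : ℝ) : Fin d → ℝ) := by
    conv_lhs => rw [pi_eq_sum_univ' a]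
    simp only [map_sum, map_smul]
  rw [toTensor_eq, ha]
  simp only [ofVec, Finset.sum_smul]
  rw [Finset.sum_comm]
  refine Finset.sum_congr rfl fun i _ => ?_
  rw [Finset.sum_eq_single ⟨[i], hκ⟩]
  · simp [monomial]
  · intro w _ hw
    rw [if_neg fun h => hw (Subtype.ext h), zero_smul]
  · simp

theorem mul_apply_eq_zero {i j : ℕ} {A B : TruncTensor d κ}
    (hA : ∀ w : Word d κ, i < w.1.length → A w = 0)
    (hB : ∀ w : Word d κ, j < w.1.length → B w = 0) (w : Word d κ) (hw : i + j < w.1.length) :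
    (A * B) w = 0 := by
  rw [mul_apply]
  refine Finset.sum_eq_zero fun n hn => ?_
  rw [Finset.mem_range] at hn
  by_cases h : i < n
  · rw [hA _ (by simp [Word.take]; omega), zero_mul]
  · rw [hB _ (by simp [Word.drop]; omega), mul_zero]

theorem rightNormed_ofVec_apply_eq_zero (a₀ : Fin d → ℝ) (l : List (Fin d → ℝ)) (w : Word d κ)
    (hw : l.length + 1 < w.1.length) : rightNormed (ofVec d κ a₀) (l.map (ofVec d κ)) w = 0 := by
  induction l generalizing w with
  | nil => exact ofVec_apply_of_length_ne (by simp at hw; omega)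
  | cons a l ih =>
    have ha (w : Word d κ) (hw : 1 < w.1.length) : ofVec d κ a w = 0 :=
      ofVec_apply_of_length_ne (by omega)
    rw [List.map_cons, rightNormed, LieRing.of_associative_ring_bracket]
    rw [List.length_cons] at hw
    have h1 := mul_apply_eq_zero ha ih w (by omega)
    have h2 := mul_apply_eq_zero ih ha w (by omega)
    rw [sub_eq_add_neg, add_apply, h1, zero_add, ← neg_one_smul ℝ, smul_apply, h2, mul_zero]

theorem rightNormed_ofVec_mem_degGE (a₀ : Fin d → ℝ) (l : List (Fin d → ℝ)) :
    rightNormed (ofVec d κ a₀) (l.map (ofVec d κ)) ∈ degGE d κ (l.length + 1) := by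
  have h1 (a : Fin d → ℝ) : ofVec d κ a ∈ degGE d κ 1 :=
    mem_degGE_one_of_mem_freeNilpotent (ofVec_mem_freeNilpotent a)
  induction l with
  | nil => exact h1 a₀
  | cons a l ih =>
    rw [List.map_cons, rightNormed, List.length_cons, add_comm]
    exact lie_mem_degGE (h1 a) ih

section Associative

attribute [local instance] LieRing.ofAssociativeRing LieAlgebra.ofAssociativeAlgebra

theorem toTensor_rightNormed (a₀ : Fin d → ℝ) (l : List (Fin d → ℝ)) (hl : l.length < κ) :
    (rightNormed (ofVec d κ a₀) (l.map (ofVec d κ))).toTensor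
      = rightNormed (TensorAlgebra.ι ℝ a₀) (l.map (TensorAlgebra.ι ℝ)) := by
  induction l with
  | nil => exact toTensor_ofVec (Nat.one_le_iff_ne_zero.2 (by simp at hl; omega)) a₀
  | cons a l ih =>
    rw [List.length_cons] at hl
    have ha (w : Word d κ) (hw : 1 < w.1.length) : ofVec d κ a w = 0 :=
      ofVec_apply_of_length_ne (by omega)
    have hl' := rightNormed_ofVec_apply_eq_zero (κ := κ) a₀ l
    simp only [List.map_cons, rightNormed, LieRing.of_associative_ring_bracket]
    rw [← toTensorₗ_apply, map_sub, toTensorₗ_apply, toTensorₗ_apply,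
      toTensor_mul (by omega) ha hl', toTensor_mul (by omega) hl' ha, ih (by omega),
      toTensor_ofVec (by omega)]

variable {B : Type*} [Ring B] [Algebra ℝ B] (Φ : TensorAlgebra ℝ (Fin d → ℝ) →ₐ[ℝ] B)

theorem map_rightNormed {L₁ L₂ : Type*} [Ring L₁] [Ring L₂] (f : L₁ →+* L₂) (a₀ : L₁)
    (l : List L₁) :
    f (rightNormed a₀ l) = rightNormed (f a₀) (l.map f) := by
  induction l with
  | nil => rfl
  | cons a l ih =>
    simp only [List.map_cons, rightNormed, LieRing.of_associative_ring_bracket, map_sub,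
      map_mul, ih]

/-- Let `Φ` be a representation of the tensor algebra in which the right-normed brackets of length
`κ + 1` of generators vanish. Although the inclusion of the truncated tensor algebra into the tensor
algebra does not respect brackets, the restriction of `Φ` to the free nilpotent Lie algebra does. -/
theorem map_toTensor_lie (hκ : 1 ≤ κ)
    (hΦ : ∀ (a₀ : Fin d → ℝ) (l : List (Fin d → ℝ)), l.length = κ →
      rightNormed (Φ (TensorAlgebra.ι ℝ a₀)) (l.map fun a => Φ (TensorAlgebra.ι ℝ a)) = 0)
    {A A' : TruncTensor d κ} (hA : A ∈ freeNilpotent d κ) (hA' : A' ∈ freeNilpotent d κ) :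
    Φ (⁅A, A'⁆ : TruncTensor d κ).toTensor = ⁅Φ A.toTensor, Φ A'.toTensor⁆ := by
  let ρ : TruncTensor d κ →ₗ[ℝ] B := Φ.toLinearMap ∘ₗ toTensorₗ d κ
  have hρ (A : TruncTensor d κ) : Φ A.toTensor = ρ A := rfl
  simp only [hρ]
  have hvec (a : Fin d → ℝ) : ρ (ofVec d κ a) = Φ (TensorAlgebra.ι ℝ a) := by
    rw [← hρ, toTensor_ofVec hκ]
  have hrn (a₀ : Fin d → ℝ) (l : List (Fin d → ℝ)) :
      ρ (rightNormed (ofVec d κ a₀) (l.map (ofVec d κ)))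
        = rightNormed (Φ (TensorAlgebra.ι ℝ a₀)) (l.map fun a => Φ (TensorAlgebra.ι ℝ a)) := by
    by_cases hl : l.length < κ
    · rw [← hρ, toTensor_rightNormed a₀ l hl]
      have := map_rightNormed (Φ : TensorAlgebra ℝ (Fin d → ℝ) →+* B) (TensorAlgebra.ι ℝ a₀)
        (l.map (TensorAlgebra.ι ℝ))
      rw [List.map_map] at this
      exact this
    · rw [eq_zero_of_mem_degGE (by omega) (rightNormed_ofVec_mem_degGE a₀ l), map_zero,
        rightNormed_eq_zero_of_le hΦ a₀ l (by omega)]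
  induction hA using LieSubalgebra.lieSpan_induction generalizing A' with
  | mem x hx =>
    obtain ⟨a, rfl⟩ := hx
    have hspan := lieSpan_le_span_rightNormed (ofVec d κ) hA'
    clear hA'
    induction hspan using Submodule.span_induction with
    | mem y hy =>
      obtain ⟨⟨a₀, l⟩, rfl⟩ := hy
      simp only
      rw [hrn, hvec]
      exact hrn a₀ (a :: l)
    | zero => rw [lie_zero, map_zero, lie_zero]
    | add y z _ _ hy hz => rw [lie_add, map_add, map_add, lie_add, hy, hz]
    | smul c y _ hy => rw [lie_smul, map_smul, map_smul, lie_smul, hy]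
  | zero => rw [zero_lie, map_zero, zero_lie]
  | add x y _ _ hx hy => rw [add_lie, map_add, map_add, add_lie, hx hA', hy hA']
  | smul c x _ hx => rw [smul_lie, map_smul, map_smul, smul_lie, hx hA']
  | lie x y hx' hy' hx hy =>
    rw [lie_lie, map_sub, hx (LieSubalgebra.lie_mem _ hy' hA'),
      hy (LieSubalgebra.lie_mem _ hx' hA'), hx hA', hy hA', hx hy', lie_lie]

end Associative

end TruncTensor

/-! ### The Lie bracket of vector fields as a commutator of operators -/

section Bracket

open VectorField

variable {E : Type*} [NormedAddCommGroup E] [NormedSpace ℝ E]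
  {M : Type*} [TopologicalSpace M] [ChartedSpace E M] [IsManifold 𝓘(ℝ, E) ∞ M]

namespace SmoothVectorField

theorem toOperator_apply (X : SmoothVectorField E M) (f : C^∞⟮𝓘(ℝ, E), M; ℝ⟯) (x : M) :
    X.toOperator f x = (mfderiv 𝓘(ℝ, E) 𝓘(ℝ, ℝ) f x (X x) : ℝ) := rfl

/-- The coordinate expression of a vector field in the preferred chart at `x₀`. -/
def chartRep (X : SmoothVectorField E M) (x₀ : M) : E → E :=
  mpullbackWithin 𝓘(ℝ, E) 𝓘(ℝ, E) (extChartAt 𝓘(ℝ, E) x₀).symm X (range 𝓘(ℝ, E))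

theorem contDiffAt_comp_extChartAt_symm (f : C^∞⟮𝓘(ℝ, E), M; ℝ⟯) (x₀ : M) {u : E}
    (hu : u ∈ (extChartAt 𝓘(ℝ, E) x₀).target) :
    ContDiffAt ℝ ∞ (fun v => f ((extChartAt 𝓘(ℝ, E) x₀).symm v)) u := by
  have h1 := (contMDiffOn_extChartAt_symm (I := 𝓘(ℝ, E)) (n := ∞) x₀).contMDiffAt
    ((isOpen_extChartAt_target x₀).mem_nhds hu)
  exact (f.contMDiff.contMDiffAt.comp u h1).contDiffAt

theorem toOperator_apply_extChartAt_symm (X : SmoothVectorField E M)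
    (f : C^∞⟮𝓘(ℝ, E), M; ℝ⟯) (x₀ : M) {u : E} (hu : u ∈ (extChartAt 𝓘(ℝ, E) x₀).target) :
    X.toOperator f ((extChartAt 𝓘(ℝ, E) x₀).symm u)
      = fderiv ℝ (fun v => f ((extChartAt 𝓘(ℝ, E) x₀).symm v)) u (X.chartRep x₀ u) := by
  have : IsManifold 𝓘(ℝ, E) 1 M := .of_le (n := ∞) (by simp)
  have h1 := (contMDiffOn_extChartAt_symm (I := 𝓘(ℝ, E)) (n := ∞) x₀).contMDiffAt
    ((isOpen_extChartAt_target x₀).mem_nhds hu)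
  have hd : MDifferentiableAt 𝓘(ℝ, E) 𝓘(ℝ, E) (extChartAt 𝓘(ℝ, E) x₀).symm u :=
    h1.mdifferentiableAt (by simp)
  have hf : MDifferentiableAt 𝓘(ℝ, E) 𝓘(ℝ, ℝ) f ((extChartAt 𝓘(ℝ, E) x₀).symm u) :=
    f.contMDiff.mdifferentiable (by simp) _
  have hcomp := mfderiv_comp u hf hd
  rw [mfderiv_eq_fderiv] at hcomp
  have hinv := isInvertible_mfderivWithin_extChartAt_symm (I := 𝓘(ℝ, E)) hu
  rw [modelWithCornersSelf_coe, range_id, mfderivWithin_univ] at hinv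
  have happ := hinv.self_comp_inverse
  have h2 : fderiv ℝ (fun v => f ((extChartAt 𝓘(ℝ, E) x₀).symm v)) u = _ := hcomp
  rw [h2, chartRep, mpullbackWithin_apply, modelWithCornersSelf_coe, range_id, mfderivWithin_univ,
    toOperator_apply]
  have := congrArg (fun A => A (X ((extChartAt 𝓘(ℝ, E) x₀).symm u))) happ
  exact congrArg (mfderiv 𝓘(ℝ, E) 𝓘(ℝ, ℝ) f ((extChartAt 𝓘(ℝ, E) x₀).symm u)) this.symm

variable [FiniteDimensional ℝ E]

theorem contDiffAt_chartRep (X : SmoothVectorField E M) (x₀ : M) :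
    ContDiffAt ℝ 1 (X.chartRep x₀) (extChartAt 𝓘(ℝ, E) x₀ x₀) := by
  have := FiniteDimensional.complete ℝ E
  have h : IsManifold 𝓘(ℝ, E) (2 + 1) M := .of_le (n := ∞) (by norm_cast)
  have := contMDiffWithinAt_mpullbackWithin_extChartAt_symm (I := 𝓘(ℝ, E)) (s := univ) (n := 2)
    (m := 1) (V := X) (x := x₀) ((X.contMDiff.of_le (by norm_cast)).contMDiffAt.contMDiffWithinAt)
    uniqueMDiffOn_univ (mem_univ _) (by norm_num)
  rw [contMDiffWithinAt_vectorSpace_iff_contDiffWithinAt] at this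
  rw [preimage_univ, inter_univ] at this
  exact this.contDiffAt (extChartAt_target_mem_nhds _)

/-- The Lie bracket of two smooth vector fields. -/
def bracket (X Y : SmoothVectorField E M) : SmoothVectorField E M :=
  ⟨mlieBracket 𝓘(ℝ, E) X Y, by
    have := FiniteDimensional.complete ℝ E
    have h : IsManifold 𝓘(ℝ, E) (minSmoothness ℝ 2) M := .of_le (n := ∞) (by simp; norm_cast)
    have h' : IsManifold 𝓘(ℝ, E) (((⊤ : ℕ∞) : ℕ∞ω) + 1) M := by simpa using ‹IsManifold 𝓘(ℝ, E) ∞ M›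
    exact ContDiff.mlieBracket_vectorField (n := ⊤) (m := ⊤) X.contMDiff Y.contMDiff (by simp)⟩

theorem coe_bracket (X Y : SmoothVectorField E M) :
    ⇑(bracket X Y) = mlieBracket 𝓘(ℝ, E) X Y := rfl

theorem toOperator_bracket_apply (X Y : SmoothVectorField E M) (f : C^∞⟮𝓘(ℝ, E), M; ℝ⟯) (x₀ : M) :
    (bracket X Y).toOperator f x₀ = fderiv ℝ (fun v => f ((extChartAt 𝓘(ℝ, E) x₀).symm v))
      (extChartAt 𝓘(ℝ, E) x₀ x₀)
      (lieBracket ℝ (X.chartRep x₀) (Y.chartRep x₀) (extChartAt 𝓘(ℝ, E) x₀ x₀)) := by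
  have : IsManifold 𝓘(ℝ, E) 1 M := .of_le (n := ∞) (by simp)
  set φ := extChartAt 𝓘(ℝ, E) x₀ with hφ
  have hu₀t : φ x₀ ∈ φ.target := mem_extChartAt_target x₀
  have hφd : MDifferentiableAt 𝓘(ℝ, E) 𝓘(ℝ, E) φ x₀ :=
    mdifferentiableAt_extChartAt (mem_chart_source E x₀)
  have hFd : MDifferentiableAt 𝓘(ℝ, E) 𝓘(ℝ, ℝ) (fun v => f (φ.symm v)) (φ x₀) :=
    ((contDiffAt_comp_extChartAt_symm f x₀ hu₀t).differentiableAt (by simp)).mdifferentiableAt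
  have hcomp := mfderiv_comp x₀ hFd hφd
  have hev : (fun v => f (φ.symm v)) ∘ φ =ᶠ[nhds x₀] f := by
    filter_upwards [extChartAt_source_mem_nhds (I := 𝓘(ℝ, E)) x₀] with x hx
    exact congrArg f (φ.left_inv hx)
  rw [hev.mfderiv_eq, mfderiv_eq_fderiv] at hcomp
  have hinv := isInvertible_mfderiv_extChartAt (I := 𝓘(ℝ, E)) (mem_extChartAt_source x₀)
  have happ := hinv.self_comp_inverse
  rw [toOperator_apply, coe_bracket, mlieBracket, mlieBracketWithin_apply, preimage_univ,
    univ_inter]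
  have hr : range 𝓘(ℝ, E) = univ := range_id
  have hlie : lieBracketWithin ℝ (X.chartRep x₀) (Y.chartRep x₀) (range 𝓘(ℝ, E)) (φ x₀)
      = lieBracket ℝ (X.chartRep x₀) (Y.chartRep x₀) (φ x₀) := by
    rw [hr, lieBracketWithin_univ]
  rw [← hlie]
  set b : E := lieBracketWithin ℝ (X.chartRep x₀) (Y.chartRep x₀) (range 𝓘(ℝ, E)) (φ x₀)
  have h1 := congrArg (fun A => A b) happ
  have h2 := congrArg (fun w : E => fderiv ℝ (fun v => f (φ.symm v)) (φ x₀) w) h1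
  refine Eq.trans ?_ h2
  exact congrArg (fun A => A ((mfderiv 𝓘(ℝ, E) 𝓘(ℝ, E) φ x₀).inverse b)) hcomp

/-- In a chart, both sides are computed with the symmetry of the second derivative. -/
theorem toOperator_bracket (X Y : SmoothVectorField E M) :
    (bracket X Y).toOperator = ⁅X.toOperator, Y.toOperator⁆ := by
  ext f x₀
  rw [toOperator_bracket_apply, Ring.lie_def]
  set φ := extChartAt 𝓘(ℝ, E) x₀ with hφ
  set u₀ := φ x₀ with hu₀
  set F : E → ℝ := fun v => f (φ.symm v) with hF
  have hmem : ∀ᶠ u in nhds u₀, u ∈ φ.target := extChartAt_target_mem_nhds x₀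
  have hu₀t : u₀ ∈ φ.target := mem_extChartAt_target x₀
  have hx₀ : φ.symm u₀ = x₀ := extChartAt_to_inv x₀
  have hF2 : ContDiffAt ℝ 2 F u₀ :=
    (contDiffAt_comp_extChartAt_symm f x₀ hu₀t).of_le (by norm_cast)
  have hF' : DifferentiableAt ℝ (fderiv ℝ F) u₀ :=
    (hF2.fderiv_right (m := 1) (by norm_num)).differentiableAt (by simp)
  have hsymm := hF2.isSymmSndFDerivAt (by simp)
  have key (X Y : SmoothVectorField E M) : X.toOperator (Y.toOperator f) x₀
      = fderiv ℝ (fderiv ℝ F) u₀ (X.chartRep x₀ u₀) (Y.chartRep x₀ u₀)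
        + fderiv ℝ F u₀ (fderiv ℝ (Y.chartRep x₀) u₀ (X.chartRep x₀ u₀)) := by
    have hY : DifferentiableAt ℝ (Y.chartRep x₀) u₀ :=
      (contDiffAt_chartRep Y x₀).differentiableAt (by simp)
    have h1 := toOperator_apply_extChartAt_symm X (Y.toOperator f) x₀ hu₀t
    have h2 : (fun v => (Y.toOperator f) (φ.symm v)) =ᶠ[nhds u₀]
        fun u => fderiv ℝ F u (Y.chartRep x₀ u) := by
      filter_upwards [hmem] with u hu using toOperator_apply_extChartAt_symm Y f x₀ hu
    rw [← hφ, hx₀, h2.fderiv_eq, fderiv_clm_apply hF' hY] at h1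
    rw [h1]
    simp [add_comm]
  change _ = X.toOperator (Y.toOperator f) x₀ - Y.toOperator (X.toOperator f) x₀
  rw [key, key, hsymm.eq, lieBracket, map_sub]
  ring

end SmoothVectorField

end Bracket

/-! ### Smooth functions as coordinates -/

section Coordinates

variable {E : Type*} [NormedAddCommGroup E] [NormedSpace ℝ E]
  {M : Type*} [TopologicalSpace M] [ChartedSpace E M]

/-- A coordinate system around `x₀` whose coordinate functions `coord i` are restrictions of
globally defined smooth functions. It maps the open set `source` bijectively onto the open set
`target` of `ℝⁿ`, with smooth inverse `inv`. -/
structure CoordinateSystem (E : Type*) [NormedAddCommGroup E] [NormedSpace ℝ E]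
    {M : Type*} [TopologicalSpace M] [ChartedSpace E M] (x₀ : M) where
  /-- The number of coordinates. -/
  dim : ℕ
  /-- The coordinate functions. -/
  coord : Fin dim → C^∞⟮𝓘(ℝ, E), M; ℝ⟯
  /-- The domain of the coordinate system. -/
  source : Set M
  /-- The image of the coordinate system. -/
  target : Set (Fin dim → ℝ)
  /-- The parametrization inverse to the coordinates. -/
  inv : (Fin dim → ℝ) → M
  isOpen_source : IsOpen source
  mem_source : x₀ ∈ source
  isOpen_target : IsOpen target
  map_source : ∀ x ∈ source, (fun i => coord i x) ∈ target
  left_inv : ∀ x ∈ source, inv (fun i => coord i x) = x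
  map_target : ∀ u ∈ target, inv u ∈ source
  right_inv : ∀ u ∈ target, (fun i => coord i (inv u)) = u
  contMDiffOn_inv : ContMDiffOn 𝓘(ℝ, Fin dim → ℝ) 𝓘(ℝ, E) ∞ inv target

namespace CoordinateSystem

variable {x₀ : M} (c : CoordinateSystem E x₀)

/-- The coordinates of a point. -/
def map (x : M) : Fin c.dim → ℝ := fun i => c.coord i x

theorem contMDiff_map : ContMDiff 𝓘(ℝ, E) 𝓘(ℝ, Fin c.dim → ℝ) ∞ c.map :=
  contMDiff_pi_space.2 fun i => (c.coord i).contMDiff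

theorem continuous_map : Continuous c.map := c.contMDiff_map.continuous

theorem contDiffOn_comp_inv (g : C^∞⟮𝓘(ℝ, E), M; ℝ⟯) :
    ContDiffOn ℝ ∞ (fun u => g (c.inv u)) c.target :=
  contMDiffOn_iff_contDiffOn.1 (g.contMDiff.comp_contMDiffOn c.contMDiffOn_inv)

variable [IsManifold 𝓘(ℝ, E) ∞ M]

theorem mfderiv_map_apply (X : SmoothVectorField E M) (x : M) :
    (mfderiv 𝓘(ℝ, E) 𝓘(ℝ, Fin c.dim → ℝ) c.map x (X x) : Fin c.dim → ℝ)
      = fun i => X.toOperator (c.coord i) x := by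
  have hd : MDifferentiableAt 𝓘(ℝ, E) 𝓘(ℝ, Fin c.dim → ℝ) c.map x :=
    c.contMDiff_map.mdifferentiable (by simp) x
  funext i
  have hp : MDifferentiableAt 𝓘(ℝ, Fin c.dim → ℝ) 𝓘(ℝ, ℝ)
      (ContinuousLinearMap.proj (R := ℝ) (φ := fun _ : Fin c.dim => ℝ) i) (c.map x) :=
    (ContinuousLinearMap.differentiableAt _).mdifferentiableAt
  have h := mfderiv_comp x hp hd
  rw [mfderiv_eq_fderiv, ContinuousLinearMap.fderiv] at h
  exact (congrArg (fun A => A (X x)) h).symm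

/-- A smooth vector field acts on functions through its action on the coordinates. -/
theorem toOperator_eq_fderiv (X : SmoothVectorField E M) (g : C^∞⟮𝓘(ℝ, E), M; ℝ⟯) {x : M}
    (hx : x ∈ c.source) :
    X.toOperator g x = fderiv ℝ (fun u => g (c.inv u)) (c.map x)
      (fun i => X.toOperator (c.coord i) x) := by
  have hd : MDifferentiableAt 𝓘(ℝ, E) 𝓘(ℝ, Fin c.dim → ℝ) c.map x :=
    c.contMDiff_map.mdifferentiable (by simp) x
  have hg : MDifferentiableAt 𝓘(ℝ, Fin c.dim → ℝ) 𝓘(ℝ, ℝ) (fun u => g (c.inv u)) (c.map x) :=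
    (((c.contDiffOn_comp_inv g).contDiffAt
      (c.isOpen_target.mem_nhds (c.map_source x hx))).differentiableAt (by simp)).mdifferentiableAt
  have hcomp := mfderiv_comp x hg hd
  have hev : (fun u => g (c.inv u)) ∘ c.map =ᶠ[nhds x] g := by
    filter_upwards [c.isOpen_source.mem_nhds hx] with y hy
    exact congrArg g (c.left_inv y hy)
  rw [hev.mfderiv_eq, mfderiv_eq_fderiv] at hcomp
  rw [← c.mfderiv_map_apply]
  exact congrArg (fun A => A (X x)) hcomp

end CoordinateSystem

variable [FiniteDimensional ℝ E] [IsManifold 𝓘(ℝ, E) ∞ M]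

theorem exists_smooth_bump [T2Space M] {x : M} {s : Set M} (hs : s ∈ nhds x) :
    ∃ f : C^∞⟮𝓘(ℝ, E), M; ℝ⟯, f x = 1 ∧ ∀ y ∉ s, f y = 0 := by
  obtain ⟨f, _, hf⟩ := (SmoothBumpFunction.nhds_basis_tsupport (I := 𝓘(ℝ, E)) x).mem_iff.1 hs
  exact ⟨⟨f, f.contMDiff⟩, f.eq_one, fun y hy =>
    image_eq_zero_of_notMem_tsupport fun h => hy (hf h)⟩

/-- The coordinates of a chart, cut off by a bump function. -/
theorem nonempty_coordinateSystem [T2Space M] (x₀ : M) : Nonempty (CoordinateSystem E x₀) := by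
  obtain ⟨χ⟩ : Nonempty (SmoothBumpFunction 𝓘(ℝ, E) x₀) := inferInstance
  let e : E ≃L[ℝ] (Fin (Module.finrank ℝ E) → ℝ) := (Module.finBasis ℝ E).equivFunL
  set φ := extChartAt 𝓘(ℝ, E) x₀ with hφ
  have hball : Metric.ball (φ x₀) χ.rIn ⊆ φ.target := by
    intro u hu
    refine χ.closedBall_subset ⟨?_, ?_⟩
    · exact Metric.closedBall_subset_closedBall χ.rIn_lt_rOut.le (Metric.ball_subset_closedBall hu)
    · simp
  have hsm (i) : ContMDiffOn 𝓘(ℝ, E) 𝓘(ℝ, ℝ) ∞ (fun x => e (φ x) i) (chartAt E x₀).source := by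
    have h1 : ContMDiffOn 𝓘(ℝ, E) 𝓘(ℝ, E) ∞ φ (chartAt E x₀).source := contMDiffOn_extChartAt
    have h2 : ContDiff ℝ ∞ (fun v : E => e v i) :=
      (contDiff_apply ℝ ℝ i).comp e.contDiff
    exact h2.contMDiff.comp_contMDiffOn h1
  have hone : ∀ x ∈ φ.source, φ x ∈ Metric.ball (φ x₀) χ.rIn → χ x = 1 := by
    intro x hx hx'
    exact χ.one_of_dist_le (by rwa [← extChartAt_source 𝓘(ℝ, E)]) (le_of_lt hx')
  have hinv : ContMDiffOn 𝓘(ℝ, Fin (Module.finrank ℝ E) → ℝ) 𝓘(ℝ, E) ∞ (fun u => φ.symm (e.symm u))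
      (e.symm ⁻¹' Metric.ball (φ x₀) χ.rIn) := by
    have h1 : ContMDiffOn 𝓘(ℝ, E) 𝓘(ℝ, E) ∞ φ.symm φ.target := contMDiffOn_extChartAt_symm x₀
    exact (h1.mono hball).comp e.symm.contDiff.contMDiff.contMDiffOn fun u hu => hu
  exact ⟨{
    dim := Module.finrank ℝ E
    coord := fun i => ⟨fun x => χ x • e (φ x) i, χ.contMDiff_smul (hsm i)⟩
    source := φ.source ∩ φ ⁻¹' Metric.ball (φ x₀) χ.rIn
    target := e.symm ⁻¹' Metric.ball (φ x₀) χ.rIn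
    inv := fun u => φ.symm (e.symm u)
    isOpen_source := isOpen_extChartAt_preimage' x₀ Metric.isOpen_ball
    mem_source := ⟨mem_extChartAt_source x₀, Metric.mem_ball_self χ.rIn_pos⟩
    isOpen_target := Metric.isOpen_ball.preimage e.symm.continuous
    map_source := fun x hx => by
      have : (fun i => χ x • e (φ x) i) = e (φ x) := by simp [hone x hx.1 hx.2]
      change e.symm (fun i => χ x • e (φ x) i) ∈ Metric.ball (φ x₀) χ.rIn
      rw [this, e.symm_apply_apply]
      exact hx.2
    left_inv := fun x hx => by
      have : (fun i => χ x • e (φ x) i) = e (φ x) := by simp [hone x hx.1 hx.2]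
      change φ.symm (e.symm (fun i => χ x • e (φ x) i)) = x
      rw [this, e.symm_apply_apply, φ.left_inv hx.1]
    map_target := fun u hu => ⟨φ.map_target (hball hu), by
      change φ (φ.symm (e.symm u)) ∈ Metric.ball (φ x₀) χ.rIn
      rw [φ.right_inv (hball hu)]
      exact hu⟩
    right_inv := fun u hu => by
      funext i
      change χ (φ.symm (e.symm u)) • e (φ (φ.symm (e.symm u))) i = u i
      rw [hone _ (φ.map_target (hball hu)) (by rw [φ.right_inv (hball hu)]; exact hu), one_smul,
        φ.right_inv (hball hu), e.apply_symm_apply]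
    contMDiffOn_inv := hinv }⟩

/-- A vector field is determined by its action on smooth functions. -/
theorem SmoothVectorField.toOperator_injective [T2Space M] :
    Function.Injective (SmoothVectorField.toOperator : SmoothVectorField E M →ₗ[ℝ] _) := by
  refine (injective_iff_map_eq_zero _).2 fun X hX => ?_
  ext x₀
  obtain ⟨c⟩ := nonempty_coordinateSystem (E := E) x₀
  have hd : MDifferentiableAt 𝓘(ℝ, E) 𝓘(ℝ, Fin c.dim → ℝ) c.map x₀ :=
    c.contMDiff_map.mdifferentiable (by simp) x₀
  have hi : MDifferentiableAt 𝓘(ℝ, Fin c.dim → ℝ) 𝓘(ℝ, E) c.inv (c.map x₀) :=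
    (c.contMDiffOn_inv.contMDiffAt (c.isOpen_target.mem_nhds
      (c.map_source x₀ c.mem_source))).mdifferentiableAt (by simp)
  have hev : c.inv ∘ c.map =ᶠ[nhds x₀] id := by
    filter_upwards [c.isOpen_source.mem_nhds c.mem_source] with y hy using c.left_inv y hy
  have h := ((hi.hasMFDerivAt.comp x₀ hd.hasMFDerivAt).congr_of_eventuallyEq hev.symm).mfderiv
  rw [mfderiv_id] at h
  have h0 : (mfderiv 𝓘(ℝ, E) 𝓘(ℝ, Fin c.dim → ℝ) c.map x₀ (X x₀) : Fin c.dim → ℝ) = 0 := by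
    rw [c.mfderiv_map_apply, hX]
    rfl
  have h1 := congrArg (fun A => A (X x₀)) h
  refine Eq.trans h1 ?_
  exact (congrArg (mfderiv 𝓘(ℝ, Fin c.dim → ℝ) 𝓘(ℝ, E) c.inv (c.map x₀)) h0).trans (map_zero _)

end Coordinates

/-! ### The first variation of an ordinary differential equation in a vector space -/

section VectorSpaceVariation

variable {H W : Type*} [NormedAddCommGroup H] [NormedSpace ℝ H] [NormedAddCommGroup W]
  [NormedSpace ℝ W]

/-- Uniform bounds for a smooth map and its derivative, and the second order Taylor estimate, on a
closed ball. -/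
theorem exists_closedBall_taylor_bounds {G : Type*} [NormedAddCommGroup G] [NormedSpace ℝ G]
    {Γ : H → G} {Ω : Set H} (hΩ : IsOpen Ω) (hΓ : ContDiffOn ℝ ∞ Γ Ω) {u₀ : H} (hu₀ : u₀ ∈ Ω) :
    ∃ r > 0, ∃ K > 0, Metric.closedBall u₀ r ⊆ Ω ∧ ∀ p ∈ Metric.closedBall u₀ r,
      ‖Γ p‖ ≤ K ∧ ‖fderiv ℝ Γ p‖ ≤ K ∧ ∀ q ∈ Metric.closedBall u₀ r, ‖Γ q - Γ p‖ ≤ K * ‖q - p‖ ∧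
        ‖Γ q - Γ p - fderiv ℝ Γ p (q - p)‖ ≤ K * ‖q - p‖ ^ 2 := by
  have hat : ContDiffAt ℝ ∞ Γ u₀ := hΓ.contDiffAt (hΩ.mem_nhds hu₀)
  have hd : ContDiffAt ℝ 1 (fderiv ℝ Γ) u₀ := hat.fderiv_right (m := 1) (by norm_cast)
  obtain ⟨K₁, s₁, hs₁, hK₁⟩ := (hat.of_le (by simp) : ContDiffAt ℝ 1 Γ u₀).exists_lipschitzOnWith
  obtain ⟨K₂, s₂, hs₂, hK₂⟩ := hd.exists_lipschitzOnWith
  have hb₁ : ∀ᶠ p in nhds u₀, ‖Γ p‖ < ‖Γ u₀‖ + 1 :=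
    hat.continuousAt.norm.eventually_lt_const (by linarith)
  have hb₂ : ∀ᶠ p in nhds u₀, ‖fderiv ℝ Γ p‖ < ‖fderiv ℝ Γ u₀‖ + 1 :=
    hd.continuousAt.norm.eventually_lt_const (by linarith)
  obtain ⟨r, hr, hball⟩ := Metric.nhds_basis_closedBall.mem_iff.1
    (Filter.inter_mem (Filter.inter_mem hs₁ hs₂) (Filter.inter_mem (hΩ.mem_nhds hu₀)
      (Filter.inter_mem hb₁ hb₂)))
  set K : ℝ := K₁ + K₂ + (‖Γ u₀‖ + 1) + (‖fderiv ℝ Γ u₀‖ + 1) with hK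
  have h1 : (0 : ℝ) ≤ K₁ := K₁.2
  have h2 : (0 : ℝ) ≤ K₂ := K₂.2
  have h3 := norm_nonneg (Γ u₀)
  have h4 := norm_nonneg (fderiv ℝ Γ u₀)
  refine ⟨r, hr, K, by positivity, fun p hp => (hball hp).2.1,
    fun p hp => ⟨?_, ?_, fun q hq => ⟨?_, ?_⟩⟩⟩
  · have : ‖Γ p‖ < ‖Γ u₀‖ + 1 := (hball hp).2.2.1
    linarith
  · have : ‖fderiv ℝ Γ p‖ < ‖fderiv ℝ Γ u₀‖ + 1 := (hball hp).2.2.2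
    linarith
  · refine (hK₁.norm_sub_le (hball hq).1.1 (hball hp).1.1).trans ?_
    gcongr
    linarith
  · have hseg : segment ℝ p q ⊆ Metric.closedBall u₀ r :=
      (convex_closedBall u₀ r).segment_subset hp hq
    have := (convex_segment p q).norm_image_sub_le_of_norm_hasFDerivWithin_le' (f := Γ)
      (f' := fderiv ℝ Γ) (φ := fderiv ℝ Γ p) (C := K * ‖q - p‖) (fun x hx => ?_) (fun x hx => ?_)
      (left_mem_segment ℝ p q) (right_mem_segment ℝ p q)
    · rwa [pow_two, ← mul_assoc]
    · exact ((hΓ.contDiffAt (hΩ.mem_nhds (hball (hseg hx)).2.1)).differentiableAt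
        (by simp)).hasFDerivAt.hasFDerivWithinAt
    · refine (hK₂.norm_sub_le (hball (hseg hx)).1.2 (hball hp).1.2).trans ?_
      have hx' : ‖x - p‖ ≤ ‖q - p‖ := by
        obtain ⟨θ, hθ, rfl⟩ := (segment_eq_image' ℝ p q ▸ hx : x ∈ _)
        rw [add_sub_cancel_left, norm_smul, Real.norm_of_nonneg hθ.1]
        exact mul_le_of_le_one_left (norm_nonneg _) hθ.2
      gcongr
      linarith

/-- Let `u' = Γ(u) a` and let `z` be a path of parameters for which `w = Γ(u) z` solves the
linearization along `u` of `u' = Γ(u) (a + δ a')`. Then a solution `v` of `v' = Γ(v) b` stays close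
to the approximate solution `u + δ w`, up to terms of second order and `b - a - δ a'`. -/
theorem norm_sub_variation_le {Γ : H → W →L[ℝ] H} {B : Set H} {K R Z : ℝ} (hK0 : 0 ≤ K)
    (hR0 : 0 ≤ R) (hZ0 : 0 ≤ Z)
    (hd : ∀ p ∈ B, DifferentiableAt ℝ Γ p)
    (hB : ∀ p ∈ B, ‖Γ p‖ ≤ K ∧ ‖fderiv ℝ Γ p‖ ≤ K ∧ ∀ q ∈ B, ‖Γ q - Γ p‖ ≤ K * ‖q - p‖ ∧
        ‖Γ q - Γ p - fderiv ℝ Γ p (q - p)‖ ≤ K * ‖q - p‖ ^ 2)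
    {u v : ℝ → H} {a a' b : W} {z z' : ℝ → W} {δ s s' : ℝ} (hss' : s ≤ s')
    (hu : ∀ τ ∈ Icc s s', HasDerivAt u (Γ (u τ) a) τ)
    (hv : ∀ τ ∈ Icc s s', HasDerivAt v (Γ (v τ) b) τ)
    (hz : ∀ τ, HasDerivAt z (z' τ) τ) (hZ : ∀ τ ∈ Icc s s', ‖z τ‖ ≤ Z)
    (hid : ∀ τ ∈ Icc s s', fderiv ℝ Γ (u τ) (Γ (u τ) a) (z τ) + Γ (u τ) (z' τ)
      - fderiv ℝ Γ (u τ) (Γ (u τ) (z τ)) a = Γ (u τ) a')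
    (huB : ∀ τ ∈ Icc s s', u τ ∈ B) (hvB : ∀ τ ∈ Icc s s', v τ ∈ B)
    (hwB : ∀ τ ∈ Icc s s', u τ + δ • Γ (u τ) (z τ) ∈ B) (hb : ‖b‖ ≤ R) :
    ‖v s' - u s' - δ • Γ (u s') (z s')‖ ≤
      gronwallBound ‖v s - u s - δ • Γ (u s) (z s)‖ (K * R)
        (K * ‖b - a - δ • a'‖ + K * (|δ| * (K * Z)) * ‖b - a‖ + K * (|δ| * (K * Z)) ^ 2 * R)
        (s' - s) := by
  have hwd : ∀ τ ∈ Icc s s', HasDerivAt (fun τ => u τ + δ • Γ (u τ) (z τ))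
      (Γ (u τ) a + δ • (fderiv ℝ Γ (u τ) (Γ (u τ) a) (z τ) + Γ (u τ) (z' τ))) τ := by
    intro τ hτ
    have h1 : HasDerivAt (fun τ => Γ (u τ)) (fderiv ℝ Γ (u τ) (Γ (u τ) a)) τ :=
      (hd _ (huB τ hτ)).hasFDerivAt.comp_hasDerivAt τ (hu τ hτ)
    exact (hu τ hτ).add ((h1.clm_apply (hz τ)).const_smul δ)
  have hsub : ∀ τ ∈ Ico s s', τ ∈ Icc s s' := fun τ hτ => Ico_subset_Icc_self hτ
  have key := dist_le_of_approx_trajectories_ODE_of_mem (v := fun _ p => Γ p b)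
    (s := fun _ => B) (K := ⟨K * R, by positivity⟩) (f := v)
    (g := fun τ => u τ + δ • Γ (u τ) (z τ)) (f' := fun τ => Γ (v τ) b)
    (g' := fun τ => Γ (u τ) a + δ • (fderiv ℝ Γ (u τ) (Γ (u τ) a) (z τ) + Γ (u τ) (z' τ)))
    (a := s) (b := s') (εf := 0)
    (εg := K * ‖b - a - δ • a'‖ + K * (|δ| * (K * Z)) * ‖b - a‖ + K * (|δ| * (K * Z)) ^ 2 * R)
    (δ := ‖v s - u s - δ • Γ (u s) (z s)‖)
    (fun _ _ => ?_) (fun τ hτ => (hv τ hτ).continuousAt.continuousWithinAt)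
    (fun τ hτ => (hv τ (hsub τ hτ)).hasDerivWithinAt) (fun τ _ => by simp)
    (fun τ hτ => hvB τ (hsub τ hτ)) (fun τ hτ => (hwd τ hτ).continuousAt.continuousWithinAt)
    (fun τ hτ => (hwd τ (hsub τ hτ)).hasDerivWithinAt) (fun τ hτ => ?_)
    (fun τ hτ => hwB τ (hsub τ hτ)) (by rw [dist_eq_norm, sub_sub]) s' (right_mem_Icc.2 hss')
  · rw [dist_eq_norm, ← sub_sub, zero_add] at key
    exact key
  · refine LipschitzOnWith.of_dist_le_mul fun p hp q hq => ?_
    rw [dist_eq_norm, dist_eq_norm, ← sub_apply]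
    refine ((Γ p - Γ q).le_opNorm b).trans ?_
    have := ((hB q hq).2.2 p hp).1
    calc ‖Γ p - Γ q‖ * ‖b‖ ≤ (K * ‖p - q‖) * R := by gcongr
      _ = K * R * ‖p - q‖ := by ring
  · have hτ' := hsub τ hτ
    set p := u τ with hp
    set w := Γ p (z τ) with hw
    have hw' : ‖δ • w‖ ≤ |δ| * (K * Z) := by
      rw [norm_smul, Real.norm_eq_abs]
      gcongr
      exact ((Γ p).le_opNorm _).trans (by
        gcongr
        exacts [(hB p (huB τ hτ')).1, hZ τ hτ'])
    have hw0 : 0 ≤ |δ| * (K * Z) := by positivity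
    -- split the defect of the approximate solution into three small terms
    have hsplit : Γ p a + δ • (fderiv ℝ Γ p (Γ p a) (z τ) + Γ p (z' τ)) - Γ (p + δ • w) b
        = -(Γ p (b - a - δ • a')) - fderiv ℝ Γ p (δ • w) (b - a)
          - (Γ (p + δ • w) - Γ p - fderiv ℝ Γ p (p + δ • w - p)) b := by
      have h := hid τ hτ'
      rw [sub_eq_iff_eq_add] at h
      rw [h, add_sub_cancel_left]
      simp only [map_sub, map_smul, sub_apply, smul_apply,
        smul_add]
      abel
    rw [dist_eq_norm, hsplit]
    have hBp := hB p (huB τ hτ')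
    have e1 : ‖Γ p (b - a - δ • a')‖ ≤ K * ‖b - a - δ • a'‖ :=
      ((Γ p).le_opNorm _).trans (by gcongr; exact hBp.1)
    have e2 : ‖fderiv ℝ Γ p (δ • w) (b - a)‖ ≤ K * (|δ| * (K * Z)) * ‖b - a‖ := by
      refine ((fderiv ℝ Γ p (δ • w)).le_opNorm _).trans ?_
      gcongr
      exact ((fderiv ℝ Γ p).le_opNorm _).trans (by gcongr; exact hBp.2.1)
    have e3 : ‖(Γ (p + δ • w) - Γ p - fderiv ℝ Γ p (p + δ • w - p)) b‖
        ≤ K * (|δ| * (K * Z)) ^ 2 * R := by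
      refine (ContinuousLinearMap.le_opNorm _ _).trans ?_
      have h1 := (hBp.2.2 _ (hwB τ hτ')).2
      rw [← hp, ← hw] at h1
      have h2 : K * ‖p + δ • w - p‖ ^ 2 ≤ K * (|δ| * (K * Z)) ^ 2 := by
        rw [add_sub_cancel_left]
        gcongr
      gcongr
      exact h1.trans h2
    calc _ ≤ ‖-(Γ p (b - a - δ • a'))‖ + ‖fderiv ℝ Γ p (δ • w) (b - a)‖ + _ :=
          (norm_sub_le _ _).trans (add_le_add_left (norm_sub_le _ _) _)
      _ ≤ _ := by
        rw [norm_neg]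
        gcongr

end VectorSpaceVariation

/-! ### The first variation of a flow on a manifold -/

section FirstVariation

open Filter Topology Asymptotics

variable {E : Type*} [NormedAddCommGroup E] [NormedSpace ℝ E]
  {M : Type*} [TopologicalSpace M] [ChartedSpace E M]

/-- The curve `η` has at time `t` (within `S`) the velocity which acts on smooth functions through
the operator `D`, evaluated at `η t`. -/
def HasVelocityWithinAt (η : ℝ → M) (D : Module.End ℝ C^∞⟮𝓘(ℝ, E), M; ℝ⟯) (S : Set ℝ) (t : ℝ) :
    Prop :=
  ∀ f : C^∞⟮𝓘(ℝ, E), M; ℝ⟯, HasDerivWithinAt (fun h => f (η h)) (D f (η t)) S t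

namespace CoordinateSystem

variable {x₀ : M} (c : CoordinateSystem E x₀) {W : Type*} [NormedAddCommGroup W] [NormedSpace ℝ W]
  [FiniteDimensional ℝ W] (ρ : W →ₗ[ℝ] Module.End ℝ C^∞⟮𝓘(ℝ, E), M; ℝ⟯)

/-- The coordinate expression of a linear family of operators: the value on the coordinate
functions, at the point with given coordinates. -/
def symbol (u : Fin c.dim → ℝ) : W →L[ℝ] (Fin c.dim → ℝ) :=
  LinearMap.toContinuousLinearMap
    { toFun := fun A i => ρ A (c.coord i) (c.inv u)
      map_add' := fun A B => by ext i; simp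
      map_smul' := fun r A => by ext i; simp }

theorem symbol_apply (u : Fin c.dim → ℝ) (A : W) (i : Fin c.dim) :
    c.symbol ρ u A i = ρ A (c.coord i) (c.inv u) := rfl

theorem symbol_map {x : M} (hx : x ∈ c.source) (A : W) :
    c.symbol ρ (c.map x) A = fun i => ρ A (c.coord i) x := by
  funext i
  rw [symbol_apply]
  exact congrArg _ (c.left_inv x hx)

theorem contDiffOn_symbol : ContDiffOn ℝ ∞ (c.symbol ρ) c.target := by
  refine contDiffOn_clm_apply.2 fun A => contDiffOn_pi.2 fun i => ?_
  exact c.contDiffOn_comp_inv (ρ A (c.coord i))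

theorem fderiv_symbol_apply {u : Fin c.dim → ℝ} (hu : u ∈ c.target) (v : Fin c.dim → ℝ) (A : W)
    (i : Fin c.dim) : fderiv ℝ (c.symbol ρ) u v A i
      = fderiv ℝ (fun u => ρ A (c.coord i) (c.inv u)) u v := by
  have hd : DifferentiableAt ℝ (c.symbol ρ) u :=
    ((c.contDiffOn_symbol ρ).contDiffAt (c.isOpen_target.mem_nhds hu)).differentiableAt (by simp)
  have h := (hasFDerivAt_pi'.1 (hd.hasFDerivAt.clm_apply (hasFDerivAt_const A u)) i).fderiv
  have h' : fderiv ℝ (fun u => ρ A (c.coord i) (c.inv u)) u = _ := h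
  rw [h']
  simp

/-- In coordinates a curve with velocity `ρ A` solves `u' = symbol u A`. -/
theorem hasDerivWithinAt_map {η : ℝ → M} {A : W} {S : Set ℝ} {t : ℝ}
    (h : HasVelocityWithinAt η (ρ A) S t) (ht : η t ∈ c.source) :
    HasDerivWithinAt (fun s => c.map (η s)) (c.symbol ρ (c.map (η t)) A) S t := by
  rw [symbol_map c ρ ht]
  exact hasDerivWithinAt_pi.2 fun i => h (c.coord i)

/-- A curve whose speed in coordinates is bounded by `C` remains in the coordinate ball for a time
proportional to `1 / C`. -/
theorem mem_closedBall_of_speed_le [T2Space M] {r C s s' : ℝ}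
    (hr : Metric.closedBall (c.map x₀) r ⊆ c.target) {η : ℝ → M} (hη : Continuous η)
    (hd : ∀ τ ∈ Icc s s', η τ ∈ c.source → c.map (η τ) ∈ Metric.closedBall (c.map x₀) r →
      ∃ v, ‖v‖ ≤ C ∧ HasDerivAt (fun τ => c.map (η τ)) v τ)
    (h0 : η s ∈ c.source) (h0' : ‖c.map (η s) - c.map x₀‖ ≤ r / 2) (hC0 : 0 ≤ C) (hr0 : 0 < r)
    (hC : C * (s' - s) ≤ r / 4) :
    ∀ τ ∈ Icc s s', η τ ∈ c.source ∧ c.map (η τ) ∈ Metric.closedBall (c.map x₀) r := by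
  set N : Set M := c.inv '' Metric.closedBall (c.map x₀) (3 * r / 4) with hN
  have hsub : Metric.closedBall (c.map x₀) (3 * r / 4) ⊆ Metric.closedBall (c.map x₀) r :=
    Metric.closedBall_subset_closedBall (by linarith)
  have hNclosed : IsClosed N := ((isCompact_closedBall _ _).image_of_continuousOn
    (c.contMDiffOn_inv.continuousOn.mono (hsub.trans hr))).isClosed
  have hNsource : ∀ x ∈ N, x ∈ c.source ∧ c.map x ∈ Metric.closedBall (c.map x₀) (3 * r / 4) := by
    rintro _ ⟨u, hu, rfl⟩
    have hut := hr (hsub hu)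
    refine ⟨c.map_target u hut, ?_⟩
    have : c.map (c.inv u) = u := c.right_inv u hut
    rwa [this]
  have hNmem : ∀ x ∈ c.source, ‖c.map x - c.map x₀‖ ≤ 3 * r / 4 → x ∈ N := fun x hx hx' =>
    ⟨c.map x, by rwa [mem_closedBall_iff_norm], c.left_inv x hx⟩
  have hbound : ∀ τ ∈ Icc s s', r / 2 + C * (τ - s) ≤ 3 * r / 4 := by
    intro τ hτ
    have : C * (τ - s) ≤ C * (s' - s) := by
      gcongr
      exact hτ.2
    linarith
  set G : Set ℝ := {τ | η τ ∈ N ∧ ‖c.map (η τ) - c.map x₀‖ ≤ r / 2 + C * (τ - s)} with hG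
  have hcont : Continuous fun τ => c.map (η τ) := c.continuous_map.comp hη
  have hGclosed : IsClosed (G ∩ Icc s s') := by
    refine IsClosed.inter ((hNclosed.preimage hη).inter ?_) isClosed_Icc
    exact isClosed_le (f := fun τ => ‖c.map (η τ) - c.map x₀‖) (g := fun τ => r / 2 + C * (τ - s))
      (hcont.sub continuous_const).norm (by fun_prop)
  suffices h : Icc s s' ⊆ G from fun τ hτ =>
    ⟨(hNsource _ (h hτ).1).1, hsub (hNsource _ (h hτ).1).2⟩
  refine hGclosed.Icc_subset_of_forall_mem_nhdsWithin
    ⟨hNmem _ h0 (by linarith), by simpa using h0'⟩ ?_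
  rintro x ⟨hxG, hx⟩
  have hxs := hNsource _ hxG.1
  have hopen : ∀ᶠ τ in 𝓝 x, η τ ∈ c.source ∧ c.map (η τ) ∈ Metric.ball (c.map x₀) r := by
    refine (hη.continuousAt.eventually (c.isOpen_source.mem_nhds hxs.1)).and
      (hcont.continuousAt.eventually (Metric.isOpen_ball.mem_nhds ?_))
    exact Metric.closedBall_subset_ball (by linarith) hxs.2
  obtain ⟨e, he, hball⟩ := Metric.eventually_nhds_iff_ball.1 hopen
  have hmem : Ioo x (min (x + e) s') ∈ 𝓝[>] x :=
    Ioo_mem_nhdsGT (lt_min (by linarith) hx.2)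
  refine mem_of_superset hmem fun τ hτ => ?_
  have hτe : τ < x + e := hτ.2.trans_le (min_le_left _ _)
  have hτs : τ < s' := hτ.2.trans_le (min_le_right _ _)
  have hτI : τ ∈ Icc s s' := ⟨hx.1.trans hτ.1.le, hτs.le⟩
  have hin : ∀ σ ∈ Icc x τ, η σ ∈ c.source ∧ c.map (η σ) ∈ Metric.ball (c.map x₀) r :=
    fun σ hσ => hball σ (by
      rw [Real.ball_eq_Ioo]
      exact ⟨by linarith [hσ.1], by linarith [hσ.2]⟩)
  have hspeed : ∀ σ ∈ Icc x τ, ∃ v, ‖v‖ ≤ C ∧ HasDerivAt (fun τ => c.map (η τ)) v σ :=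
    fun σ hσ => hd σ ⟨hx.1.trans hσ.1, hσ.2.trans hτs.le⟩ (hin σ hσ).1
      (Metric.ball_subset_closedBall (hin σ hσ).2)
  have hle := (convex_Icc x τ).norm_image_sub_le_of_norm_deriv_le (C := C)
    (fun σ hσ => (hspeed σ hσ).choose_spec.2.differentiableAt)
    (fun σ hσ => (hspeed σ hσ).choose_spec.2.deriv ▸ (hspeed σ hσ).choose_spec.1)
    (left_mem_Icc.2 hτ.1.le) (right_mem_Icc.2 hτ.1.le)
  rw [Real.norm_of_nonneg (by linarith [hτ.1])] at hle
  have hfin : ‖c.map (η τ) - c.map x₀‖ ≤ r / 2 + C * (τ - s) := by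
    have h1 := norm_sub_le_norm_sub_add_norm_sub (c.map (η τ)) (c.map (η x)) (c.map x₀)
    have h2 := hxG.2
    have h3 : C * (τ - s) = C * (τ - x) + C * (x - s) := by ring
    linarith
  exact ⟨hNmem _ (hin τ (right_mem_Icc.2 hτ.1.le)).1 (hfin.trans (hbound τ hτI)), hfin⟩

end CoordinateSystem

variable [FiniteDimensional ℝ E] [IsManifold 𝓘(ℝ, E) ∞ M] [T2Space M]

theorem HasVelocityWithinAt.continuousWithinAt {η : ℝ → M}
    {D : Module.End ℝ C^∞⟮𝓘(ℝ, E), M; ℝ⟯} {S : Set ℝ} {t : ℝ}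
    (h : HasVelocityWithinAt η D S t) : ContinuousWithinAt η S t := by
  intro N hN
  obtain ⟨f, hf1, hf0⟩ := exists_smooth_bump (E := E) hN
  have hc := (h f).continuousWithinAt
  have : ∀ᶠ s in 𝓝[S] t, f (η s) ≠ 0 :=
    hc.eventually_ne (show f (η t) ≠ 0 by rw [hf1]; exact one_ne_zero)
  rw [mem_map]
  filter_upwards [this] with s hs
  by_contra hcon
  exact hs (hf0 _ hcon)

variable {W : Type*} [NormedAddCommGroup W] [NormedSpace ℝ W] [FiniteDimensional ℝ W]

/-- The local version of `hasVelocityWithinAt_of_variation`, obtained from the estimate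
`norm_sub_variation_le` in a coordinate ball around `y t s₀`. -/
theorem exists_local_hasVelocityWithinAt_of_variation
    (ρ : W →ₗ[ℝ] Module.End ℝ C^∞⟮𝓘(ℝ, E), M; ℝ⟯)
    {a' : W} {z z' : ℝ → W} {A : ℝ → W} {S : Set ℝ} {t : ℝ} (ht : t ∈ S)
    (ha : ∃ X : SmoothVectorField E M, X.toOperator = ρ (A t))
    (hz : ∀ s ∈ Icc (0 : ℝ) 1, ∃ X : SmoothVectorField E M, X.toOperator = ρ (z s))
    (hzd : ∀ s, HasDerivAt z (z' s) s)
    (hbr : ∀ s ∈ Icc (0 : ℝ) 1, ρ (z' s) + ρ (A t) * ρ (z s) - ρ (z s) * ρ (A t) = ρ a')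
    (hA : HasDerivWithinAt A a' S t) {y : ℝ → ℝ → M}
    (hy : ∀ h ∈ S, ∀ s, HasVelocityWithinAt (y h) (ρ (A h)) univ s) (s₀ : ℝ) :
    ∃ ε > 0, ∀ s ∈ Icc (0 : ℝ) 1, ∀ s' ∈ Icc (0 : ℝ) 1, |s - s₀| < ε → |s' - s₀| < ε → s ≤ s' →
      HasVelocityWithinAt (fun h => y h s) (ρ (z s)) S t →
      HasVelocityWithinAt (fun h => y h s') (ρ (z s')) S t := by
  have hyc : ∀ h ∈ S, Continuous (y h) := fun h hh => continuous_iff_continuousAt.2 fun s =>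
    continuousWithinAt_univ _ _ |>.1 (hy h hh s).continuousWithinAt
  obtain ⟨c⟩ := nonempty_coordinateSystem (E := E) (y t s₀)
  set u₀ := c.map (y t s₀) with hu₀
  have hu₀t : u₀ ∈ c.target := c.map_source _ c.mem_source
  obtain ⟨r, hr, K, hK, hrt, hB⟩ :=
    exists_closedBall_taylor_bounds c.isOpen_target (c.contDiffOn_symbol ρ) hu₀t
  set Γ := c.symbol ρ with hΓ
  set R : ℝ := ‖A t‖ + 1 with hR
  have hR0 : 0 < R := by positivity
  obtain ⟨Z, hZ⟩ := isCompact_Icc.exists_bound_of_continuousOn (f := z) (s := Icc (0 : ℝ) 1)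
    fun s _ => (hzd s).continuousAt.continuousWithinAt
  have hZ0 : 0 ≤ Z := (norm_nonneg _).trans (hZ 0 (by simp))
  set u : ℝ → Fin c.dim → ℝ := fun τ => c.map (y t τ) with hu
  have hev : ∀ᶠ τ in 𝓝 s₀, y t τ ∈ c.source ∧ u τ ∈ Metric.ball u₀ (r / 4) :=
    ((hyc t ht).continuousAt.eventually (c.isOpen_source.mem_nhds c.mem_source)).and
      ((c.continuous_map.comp (hyc t ht)).continuousAt.eventually
        (Metric.isOpen_ball.mem_nhds (Metric.mem_ball_self (by positivity))))
  obtain ⟨ε₁, hε₁, hε₁'⟩ := Metric.eventually_nhds_iff.1 hev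
  refine ⟨min ε₁ (r / (8 * (K * R))), by positivity, ?_⟩
  intro s hs s' hs' hsε hs'ε hss' hP
  have hnear : ∀ τ ∈ Icc s s', y t τ ∈ c.source ∧ u τ ∈ Metric.ball u₀ (r / 4) := by
    intro τ hτ
    refine hε₁' ?_
    have h1 := abs_lt.1 (hsε.trans_le (min_le_left _ _))
    have h2 := abs_lt.1 (hs'ε.trans_le (min_le_left _ _))
    rw [Real.dist_eq]
    exact abs_lt.2 ⟨by linarith [hτ.1], by linarith [hτ.2]⟩
  have h01 : ∀ τ ∈ Icc s s', τ ∈ Icc (0 : ℝ) 1 := fun τ hτ =>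
    ⟨hs.1.trans hτ.1, hτ.2.trans hs'.2⟩
  have hlen : K * R * (s' - s) ≤ r / 4 := by
    have h1 := abs_lt.1 (hsε.trans_le (min_le_right _ _))
    have h2 := abs_lt.1 (hs'ε.trans_le (min_le_right _ _))
    have h3 : s' - s ≤ 2 * (r / (8 * (K * R))) := by linarith
    calc K * R * (s' - s) ≤ K * R * (2 * (r / (8 * (K * R)))) := by gcongr
      _ = r / 4 := by field_simp; norm_num
  have hder : ∀ h ∈ S, ∀ τ, y h τ ∈ c.source →
      HasDerivAt (fun τ => c.map (y h τ)) (Γ (c.map (y h τ)) (A h)) τ := fun h hh τ hτ =>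
    hasDerivWithinAt_univ.1 (c.hasDerivWithinAt_map ρ (hy h hh τ) hτ)
  -- the linearized equation in coordinates
  have hid : ∀ τ ∈ Icc s s', fderiv ℝ Γ (u τ) (Γ (u τ) (A t)) (z τ) + Γ (u τ) (z' τ)
      - fderiv ℝ Γ (u τ) (Γ (u τ) (z τ)) (A t) = Γ (u τ) a' := by
    intro τ hτ
    have hx := (hnear τ hτ).1
    have hut : u τ ∈ c.target := c.map_source _ hx
    obtain ⟨X, hX⟩ := ha
    obtain ⟨Y, hY⟩ := hz τ (h01 τ hτ)
    funext i
    have h1 := c.toOperator_eq_fderiv X (ρ (z τ) (c.coord i)) hx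
    have h2 := c.toOperator_eq_fderiv Y (ρ (A t) (c.coord i)) hx
    rw [hX, ← c.symbol_map ρ hx, ← c.fderiv_symbol_apply ρ hut] at h1
    rw [hY, ← c.symbol_map ρ hx, ← c.fderiv_symbol_apply ρ hut] at h2
    have h3 := congrArg (fun D => D (c.coord i) (y t τ)) (hbr τ (h01 τ hτ))
    change ρ (z' τ) (c.coord i) (y t τ) + ρ (A t) (ρ (z τ) (c.coord i)) (y t τ)
      - ρ (z τ) (ρ (A t) (c.coord i)) (y t τ) = ρ a' (c.coord i) (y t τ) at h3
    rw [h1, h2] at h3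
    change fderiv ℝ Γ (u τ) (Γ (u τ) (A t)) (z τ) i + Γ (u τ) (z' τ) i
      - fderiv ℝ Γ (u τ) (Γ (u τ) (z τ)) (A t) i = Γ (u τ) a' i
    simp only [hΓ, hu, c.symbol_map ρ hx] at h3 ⊢
    linarith
  have hPs : HasDerivWithinAt (fun h => c.map (y h s)) (Γ (u s) (z s)) S t :=
    c.hasDerivWithinAt_map ρ hP (hnear s (left_mem_Icc.2 hss')).1
  -- for `h` close to `t` the curve `y h` stays in the coordinate ball
  have hgood : ∀ᶠ h in 𝓝[S] t, h ∈ S ∧ ‖A h‖ ≤ R ∧ |h - t| * (K * Z) ≤ r / 4 ∧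
      ∀ τ ∈ Icc s s', y h τ ∈ c.source ∧ c.map (y h τ) ∈ Metric.closedBall u₀ r := by
    have hsm := hnear s (left_mem_Icc.2 hss')
    have e1 : ∀ᶠ h in 𝓝[S] t, y h s ∈ c.source :=
      hP.continuousWithinAt.eventually (c.isOpen_source.mem_nhds hsm.1)
    have e2 : ∀ᶠ h in 𝓝[S] t, c.map (y h s) ∈ Metric.ball u₀ (r / 2) :=
      hPs.continuousWithinAt.eventually (Metric.isOpen_ball.mem_nhds
        (Metric.ball_subset_ball (by linarith) hsm.2))
    have e3 : ∀ᶠ h in 𝓝[S] t, ‖A h‖ < R :=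
      hA.continuousWithinAt.norm.eventually_lt_const (by simp [hR])
    have e4 : ∀ᶠ h in 𝓝[S] t, |h - t| * (K * Z) < r / 4 := by
      have : ContinuousWithinAt (fun h => |h - t| * (K * Z)) S t :=
        Continuous.continuousWithinAt (by fun_prop)
      exact this.eventually_lt_const (by simp; positivity)
    filter_upwards [e1, e2, e3, e4, self_mem_nhdsWithin] with h e1 e2 e3 e4 hh
    refine ⟨hh, e3.le, e4.le, ?_⟩
    refine c.mem_closedBall_of_speed_le (C := K * R) hrt (hyc h hh) ?_ e1
      (by rw [← dist_eq_norm]; exact (Metric.mem_ball.1 e2).le) (by positivity) hr hlen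
    intro τ _ hτ1 hτ2
    refine ⟨_, ?_, hder h hh τ hτ1⟩
    exact ((Γ _).le_opNorm _).trans (by gcongr; exact (hB _ hτ2).1)
  have hest : ∀ᶠ h in 𝓝[S] t, ‖c.map (y h s') - u s' - (h - t) • Γ (u s') (z s')‖ ≤
      ‖c.map (y h s) - u s - (h - t) • Γ (u s) (z s)‖ * Real.exp (K * R * (s' - s)) +
      (K * ‖A h - A t - (h - t) • a'‖ + K * (|h - t| * (K * Z)) * ‖A h - A t‖
        + K * (|h - t| * (K * Z)) ^ 2 * R) / (K * R) * (Real.exp (K * R * (s' - s)) - 1) := by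
    filter_upwards [hgood] with h ⟨hh, hAR, hhZ, hball⟩
    have huB : ∀ τ ∈ Icc s s', u τ ∈ Metric.closedBall u₀ r := fun τ hτ =>
      Metric.ball_subset_closedBall (Metric.ball_subset_ball (by linarith) (hnear τ hτ).2)
    have := norm_sub_variation_le (Γ := Γ) (B := Metric.closedBall u₀ r) hK.le hR0.le hZ0
      (fun p hp => ((c.contDiffOn_symbol ρ).contDiffAt
        (c.isOpen_target.mem_nhds (hrt hp))).differentiableAt (by simp)) hB (δ := h - t)
      (v := fun τ => c.map (y h τ)) hss' (fun τ hτ => hder t ht τ (hnear τ hτ).1)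
      (fun τ hτ => hder h hh τ (hball τ hτ).1) hzd (fun τ hτ => hZ τ (h01 τ hτ)) hid huB
      (fun τ hτ => (hball τ hτ).2) (fun τ hτ => ?_) hAR
    · rwa [gronwallBound_of_K_ne_0 (by positivity)] at this
    · rw [mem_closedBall_iff_norm]
      have h1 : ‖(h - t) • Γ (u τ) (z τ)‖ ≤ r / 4 := by
        rw [norm_smul, Real.norm_eq_abs]
        refine le_trans ?_ hhZ
        gcongr
        exact ((Γ _).le_opNorm _).trans (by
          gcongr
          exacts [(hB _ (huB τ hτ)).1, hZ τ (h01 τ hτ)])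
      have h2 : ‖u τ - u₀‖ < r / 4 := by
        rw [← dist_eq_norm]
        exact (hnear τ hτ).2
      calc ‖u τ + (h - t) • Γ (u τ) (z τ) - u₀‖ = ‖(u τ - u₀) + (h - t) • Γ (u τ) (z τ)‖ := by
            congr 1; abel
        _ ≤ ‖u τ - u₀‖ + ‖(h - t) • Γ (u τ) (z τ)‖ := norm_add_le _ _
        _ ≤ r := by linarith
  have hPs' : HasDerivWithinAt (fun h => c.map (y h s')) (Γ (u s') (z s')) S t := by
    have hAcont : Tendsto A (𝓝[S] t) (𝓝 (A t)) := hA.continuousWithinAt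
    rw [hasDerivWithinAt_iff_isLittleO] at hPs hA ⊢
    refine (IsBigO.of_bound 1 ?_ : _ =O[𝓝[S] t] fun h =>
      ‖c.map (y h s) - u s - (h - t) • Γ (u s) (z s)‖ * Real.exp (K * R * (s' - s)) +
      (K * ‖A h - A t - (h - t) • a'‖ + K * (|h - t| * (K * Z)) * ‖A h - A t‖
        + K * (|h - t| * (K * Z)) ^ 2 * R) / (K * R) *
          (Real.exp (K * R * (s' - s)) - 1)).trans_isLittleO ?_
    · filter_upwards [hest] with h hh
      rw [one_mul]
      exact hh.trans (le_abs_self _)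
    · have hid1 : (fun h => |h - t|) =O[𝓝[S] t] fun h => h - t := (isBigO_refl _ _).norm_left
      have hAc : (fun h => ‖A h - A t‖) =o[𝓝[S] t] fun _ => (1 : ℝ) := by
        rw [isLittleO_one_iff]
        simpa using (tendsto_iff_norm_sub_tendsto_zero.1 hAcont)
      have htc : (fun h => |h - t|) =o[𝓝[S] t] fun _ => (1 : ℝ) := by
        rw [isLittleO_one_iff]
        have : ContinuousWithinAt (fun h => |h - t|) S t :=
          Continuous.continuousWithinAt (by fun_prop)
        simpa [ContinuousWithinAt] using this
      have o1 : (fun h => K * ‖A h - A t - (h - t) • a'‖) =o[𝓝[S] t] fun h => h - t :=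
        hA.norm_left.const_mul_left K
      have o2 : (fun h => K * (|h - t| * (K * Z)) * ‖A h - A t‖) =o[𝓝[S] t] fun h => h - t := by
        have := (hid1.mul_isLittleO hAc).const_mul_left (K * (K * Z))
        simp only [mul_one] at this
        refine this.congr_left fun h => ?_
        ring
      have o3 : (fun h => K * (|h - t| * (K * Z)) ^ 2 * R) =o[𝓝[S] t] fun h => h - t := by
        have := (hid1.mul_isLittleO htc).const_mul_left (K * (K * Z) ^ 2 * R)
        simp only [mul_one] at this
        refine this.congr_left fun h => ?_
        ring
      have o4 := ((o1.add o2).add o3).const_mul_left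
        ((K * R)⁻¹ * (Real.exp (K * R * (s' - s)) - 1))
      have o5 := hPs.norm_left.const_mul_left (Real.exp (K * R * (s' - s)))
      refine (o5.add o4).congr_left fun h => ?_
      simp only [hu]
      ring
  intro g
  obtain ⟨Y, hY⟩ := hz s' hs'
  have hs'm := (hnear s' (right_mem_Icc.2 hss')).1
  have hgd : HasFDerivAt (fun v => g (c.inv v)) (fderiv ℝ (fun v => g (c.inv v)) (u s')) (u s') :=
    (((c.contDiffOn_comp_inv g).contDiffAt
      (c.isOpen_target.mem_nhds (c.map_source _ hs'm))).differentiableAt (by simp)).hasFDerivAt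
  have hcomp := hgd.comp_hasDerivWithinAt t hPs'
  rw [← hY, c.toOperator_eq_fderiv Y g hs'm, hY, ← c.symbol_map ρ hs'm]
  refine hcomp.congr_of_eventuallyEq ?_ (congrArg g (c.left_inv _ hs'm)).symm
  filter_upwards [hgood] with h hh
  exact (congrArg g (c.left_inv _ (hh.2.2.2 s' (right_mem_Icc.2 hss')).1)).symm

/-- The first variation formula. Let `y h` be an integral curve of the field `ρ (A h)`, for every
`h`, and let `z` be a path of parameters such that the fields `ρ (z s)` solve the linearized
equation `∂ₛ Z + [X, Z] = X'` with `X = ρ (A t)` and `X' = ρ a'`, where `a'` is the derivative of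
`A` at `t`. If `h ↦ y h 0` has velocity `ρ (z 0)` at `h = t`, then `h ↦ y h 1` has velocity
`ρ (z 1)`. -/
theorem hasVelocityWithinAt_of_variation
    (ρ : W →ₗ[ℝ] Module.End ℝ C^∞⟮𝓘(ℝ, E), M; ℝ⟯)
    {a' : W} {z z' : ℝ → W} {A : ℝ → W} {S : Set ℝ} {t : ℝ} (ht : t ∈ S)
    (ha : ∃ X : SmoothVectorField E M, X.toOperator = ρ (A t))
    (hz : ∀ s ∈ Icc (0 : ℝ) 1, ∃ X : SmoothVectorField E M, X.toOperator = ρ (z s))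
    (hzd : ∀ s, HasDerivAt z (z' s) s)
    (hbr : ∀ s ∈ Icc (0 : ℝ) 1, ρ (z' s) + ρ (A t) * ρ (z s) - ρ (z s) * ρ (A t) = ρ a')
    (hA : HasDerivWithinAt A a' S t) {y : ℝ → ℝ → M}
    (hy : ∀ h ∈ S, ∀ s, HasVelocityWithinAt (y h) (ρ (A h)) univ s)
    (h0 : HasVelocityWithinAt (fun h => y h 0) (ρ (z 0)) S t) :
    HasVelocityWithinAt (fun h => y h 1) (ρ (z 1)) S t := by
  choose ε hε hstep using exists_local_hasVelocityWithinAt_of_variation ρ ht ha hz hzd hbr hA hy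
  obtain ⟨τ, hτ0, hmono, ⟨m, hm⟩, hcov⟩ := exists_monotone_Icc_subset_open_cover_unitInterval
    (c := fun s₀ : unitInterval => {s : unitInterval | |(s : ℝ) - s₀| < ε s₀})
    (fun s₀ => isOpen_lt (by fun_prop) continuous_const)
    (fun s₀ _ => mem_iUnion.2 ⟨s₀, by simpa using hε s₀⟩)
  have key : ∀ n, HasVelocityWithinAt (fun h => y h (τ n)) (ρ (z (τ n))) S t := by
    intro n
    induction n with
    | zero => rw [hτ0]; exact h0
    | succ n ih =>
      obtain ⟨i, hi⟩ := hcov n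
      have hle := hmono (Nat.le_succ n)
      exact hstep i (τ n) (τ n).2 (τ (n + 1)) (τ (n + 1)).2 (hi (left_mem_Icc.2 hle))
        (hi (right_mem_Icc.2 hle)) hle ih
  have := key m
  rwa [hm m le_rfl] at this

end FirstVariation

/-! ### The vector fields of a nilpotent system -/

section NilpotentSystem

variable {E : Type*} [NormedAddCommGroup E] [NormedSpace ℝ E]
  {M : Type*} [TopologicalSpace M] [ChartedSpace E M] [IsManifold 𝓘(ℝ, E) ∞ M]
  {d κ : ℕ} {V : (Fin d → ℝ) →ₗ[ℝ] SmoothVectorField E M}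

open TruncTensor

/-- A solution of `σ' = Y_t(σ)` has the velocity given by `Y_t` as a differential operator. -/
theorem SolvesODEOn.hasVelocityWithinAt {X : ℝ → SmoothVectorField E M} {J : Set ℝ} {σ : ℝ → M}
    (h : SolvesODEOn (fun t => ⇑(X t)) J σ) {t : ℝ} (ht : t ∈ J) :
    HasVelocityWithinAt σ (X t).toOperator J t := by
  intro f
  have hf : HasMFDerivAt 𝓘(ℝ, E) 𝓘(ℝ, ℝ) f (σ t) (mfderiv 𝓘(ℝ, E) 𝓘(ℝ, ℝ) f (σ t)) :=
    (f.contMDiff.mdifferentiable (by simp) (σ t)).hasMFDerivAt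
  let L : ℝ →L[ℝ] ℝ := (mfderiv 𝓘(ℝ, E) 𝓘(ℝ, ℝ) f (σ t)).comp
    ((1 : ℝ →L[ℝ] ℝ).smulRight (X t (σ t)))
  have hL : HasFDerivWithinAt (f ∘ σ) L J t :=
    (hf.comp_hasMFDerivWithinAt t (h t ht)).hasFDerivWithinAt
  have hc := hL.hasDerivWithinAt
  have e : mfderiv 𝓘(ℝ, E) 𝓘(ℝ, ℝ) f (σ t) ((1 : ℝ) • X t (σ t))
      = mfderiv 𝓘(ℝ, E) 𝓘(ℝ, ℝ) f (σ t) (X t (σ t)) := by rw [one_smul]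
  exact e ▸ hc

theorem solvesODEOn_univ_iff {X : SmoothVectorField E M} {σ : ℝ → M} :
    SolvesODEOn (fun _ => ⇑X) univ σ ↔ IsMIntegralCurve σ X := by
  rw [isMIntegralCurve_iff_isMIntegralCurveOn]
  rfl

/-- The assignment to a truncated tensor of an operator on functions, as a linear map. It does not
respect the truncated product. -/
def truncOperator (κ : ℕ) (V : (Fin d → ℝ) →ₗ[ℝ] SmoothVectorField E M) :
    TruncTensor d κ →ₗ[ℝ] Module.End ℝ C^∞⟮𝓘(ℝ, E), M; ℝ⟯ :=
  (extendToTensor V).toLinearMap ∘ₗ toTensorₗ d κ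

variable [FiniteDimensional ℝ E]

section

attribute [local instance] LieRing.ofAssociativeRing LieAlgebra.ofAssociativeAlgebra

/-- The iterated brackets of the system are smooth vector fields, and as operators they are iterated
commutators. -/
theorem exists_toOperator_eq_rightNormed (V : (Fin d → ℝ) →ₗ[ℝ] SmoothVectorField E M)
    (a₀ : Fin d → ℝ) (l : List (Fin d → ℝ)) :
    ∃ X : SmoothVectorField E M, ⇑X = iteratedBracket V a₀ l ∧
      X.toOperator = rightNormed (V a₀).toOperator (l.map fun a => (V a).toOperator) := by
  induction l with
  | nil => exact ⟨V a₀, rfl, rfl⟩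
  | cons a l ih =>
    obtain ⟨X, hX, hX'⟩ := ih
    refine ⟨SmoothVectorField.bracket (V a) X, ?_, ?_⟩
    · rw [SmoothVectorField.coe_bracket, hX]
      rfl
    · rw [SmoothVectorField.toOperator_bracket, hX']
      rfl

/-- On the free nilpotent Lie algebra, `A ↦ V_A` is a homomorphism of Lie algebras. -/
theorem GeneratesNilpotent.map_toTensor_lie (hV : GeneratesNilpotent κ V) (hκ : 1 ≤ κ)
    {A B : TruncTensor d κ} (hA : A ∈ freeNilpotent d κ) (hB : B ∈ freeNilpotent d κ) :
    extendToTensor V (⁅A, B⁆ : TruncTensor d κ).toTensor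
      = ⁅extendToTensor V A.toTensor, extendToTensor V B.toTensor⁆ := by
  refine TruncTensor.map_toTensor_lie (extendToTensor V) hκ (fun a₀ l hl => ?_) hA hB
  obtain ⟨X, hX, hX'⟩ := exists_toOperator_eq_rightNormed V a₀ l
  have hX0 : X = 0 := by
    ext x
    rw [hX, hV a₀ l hl]
    rfl
  rw [hX0, map_zero] at hX'
  have hι (a : Fin d → ℝ) : extendToTensor V (TensorAlgebra.ι ℝ a) = (V a).toOperator :=
    TensorAlgebra.lift_ι_apply _ _
  simp only [hι]
  exact hX'.symm

/-- The differential operator which defines the field `V_A` is a smooth vector field. -/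
theorem GeneratesNilpotent.exists_toOperator_eq (hV : GeneratesNilpotent κ V) (hκ : 1 ≤ κ)
    {A : TruncTensor d κ} (hA : A ∈ freeNilpotent d κ) :
    ∃ X : SmoothVectorField E M, X.toOperator = extendToTensor V A.toTensor := by
  have hρ (A : TruncTensor d κ) : extendToTensor V A.toTensor = truncOperator κ V A := rfl
  induction hA using LieSubalgebra.lieSpan_induction with
  | mem x hx =>
    obtain ⟨a, rfl⟩ := hx
    have hι : extendToTensor V (TensorAlgebra.ι ℝ a) = (V a).toOperator :=
      TensorAlgebra.lift_ι_apply _ _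
    exact ⟨V a, by rw [toTensor_ofVec hκ, hι]⟩
  | zero => exact ⟨0, by rw [hρ, map_zero, map_zero]⟩
  | add x y _ _ hx hy =>
    obtain ⟨X, hX⟩ := hx
    obtain ⟨Y, hY⟩ := hy
    exact ⟨X + Y, by rw [map_add, hX, hY, hρ, hρ, hρ, map_add]⟩
  | smul r x _ hx =>
    obtain ⟨X, hX⟩ := hx
    exact ⟨r • X, by rw [map_smul, hX, hρ, hρ, map_smul]⟩
  | lie x y hx' hy' hx hy =>
    obtain ⟨X, hX⟩ := hx
    obtain ⟨Y, hY⟩ := hy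
    refine ⟨SmoothVectorField.bracket X Y, ?_⟩
    rw [hV.map_toTensor_lie hκ hx' hy', SmoothVectorField.toOperator_bracket, hX, hY]

end

theorem GeneratesNilpotent.toOperator_extendVF (hV : GeneratesNilpotent κ V) (hκ : 1 ≤ κ)
    {A : TruncTensor d κ} (hA : A ∈ freeNilpotent d κ) :
    (extendVF V A).toOperator = extendToTensor V A.toTensor := by
  have h := hV.exists_toOperator_eq hκ hA
  rw [extendVF, dif_pos h]
  exact h.choose_spec

/-- The junk value of `extendVF` does not occur for a nilpotent system. -/
theorem GeneratesNilpotent.toOperator_extendVF_eq_truncOperator (hV : GeneratesNilpotent κ V)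
    (hκ : 1 ≤ κ) {A : TruncTensor d κ} (hA : A ∈ freeNilpotent d κ) :
    (extendVF V A).toOperator = truncOperator κ V A :=
  hV.toOperator_extendVF hκ hA

theorem GeneratesNilpotent.extendVF_neg [T2Space M] (hV : GeneratesNilpotent κ V) (hκ : 1 ≤ κ)
    {A : TruncTensor d κ} (hA : A ∈ freeNilpotent d κ) : extendVF V (-A) = -extendVF V A := by
  refine SmoothVectorField.toOperator_injective ?_
  have hA' : -A ∈ freeNilpotent d κ := (freeNilpotent d κ).toSubmodule.neg_mem hA
  rw [map_neg, hV.toOperator_extendVF_eq_truncOperator hκ hA,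
    hV.toOperator_extendVF_eq_truncOperator hκ hA', map_neg]

theorem GeneratesNilpotent.extendVF_zero [T2Space M] (hV : GeneratesNilpotent κ V) (hκ : 1 ≤ κ) :
    extendVF V (0 : TruncTensor d κ) = 0 := by
  refine SmoothVectorField.toOperator_injective ?_
  rw [map_zero, hV.toOperator_extendVF_eq_truncOperator hκ (zero_mem _), map_zero]

/-! ### Integral curves and flows -/

variable [T2Space M]

/-- By uniqueness of integral curves, `expFlow` does not depend on the choice of the solution. -/
theorem IsMIntegralCurve.expFlow_eq {X : SmoothVectorField E M} {σ : ℝ → M}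
    (hσ : IsMIntegralCurve σ X) : expFlow (⇑X) (σ 0) = σ 1 := by
  have : IsManifold 𝓘(ℝ, E) 1 M := .of_le (n := ∞) (by simp)
  have := FiniteDimensional.complete ℝ E
  have h : ∃ τ : ℝ → M, τ 0 = σ 0 ∧ SolvesODEOn (fun _ => ⇑X) univ τ :=
    ⟨σ, rfl, solvesODEOn_univ_iff.2 hσ⟩
  rw [expFlow, flow, dif_pos h]
  have heq := isMIntegralCurve_Ioo_eq_of_contMDiff_boundaryless (t₀ := 0)
    (X.contMDiff.of_le (by simp)) (solvesODEOn_univ_iff.1 h.choose_spec.2) hσ h.choose_spec.1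
  rw [heq]

theorem expFlow_zero (m : M) : expFlow (⇑(0 : SmoothVectorField E M)) m = m :=
  IsMIntegralCurve.expFlow_eq (X := (0 : SmoothVectorField E M)) (σ := fun _ => m)
    (isMIntegralCurve_const rfl)

theorem IsMIntegralCurve.expFlow_neg {X : SmoothVectorField E M} {σ : ℝ → M}
    (hσ : IsMIntegralCurve σ X) : expFlow (⇑(-X)) (σ 1) = σ 0 := by
  have h := (hσ.comp_mul (-1)).comp_add (-1)
  have h' : IsMIntegralCurve (fun s => σ ((s + -1) * -1)) (-X : SmoothVectorField E M) := by
    have e : (⇑(-X) : (x : M) → TangentSpace 𝓘(ℝ, E) x) = (-1 : ℝ) • ⇑X :=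
      funext fun x => (neg_one_smul ℝ (X x)).symm
    rw [e]
    exact h
  have := h'.expFlow_eq
  simpa using this

/-- Completeness along the paths `t ↦ t A` gives global integral curves of `V_A`: a solution on
`[0, 2a]` through `m` at time `a`, shifted by `a`, is an integral curve on `(-a, a)`. -/
theorem IsKappaComplete.exists_isMIntegralCurve (hV : IsKappaComplete κ V)
    {A : TruncTensor d κ} (hA : A ∈ freeNilpotent d κ) (m : M) :
    ∃ σ : ℝ → M, σ 0 = m ∧ IsMIntegralCurve σ (extendVF V A) := by
  have : IsManifold 𝓘(ℝ, E) 1 M := .of_le (n := ∞) (by simp)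
  have := FiniteDimensional.complete ℝ E
  refine (exists_isMIntegralCurve_iff_exists_isMIntegralCurveOn_Ioo
    ((extendVF V A).contMDiff.of_le (by simp)) m).2 fun a => ?_
  rcases le_or_gt a 0 with ha | ha
  · refine ⟨fun _ => m, rfl, fun t ht => ?_⟩
    linarith [ht.1, ht.2]
  have hvel : ∀ t ∈ Icc 0 (2 * a), velocity (2 * a) (fun t : ℝ => t • A) t = A := fun t ht => by
    have h : HasDerivWithinAt (fun t : ℝ => t • A) ((1 : ℝ) • A) (Icc 0 (2 * a)) t :=
      (hasDerivWithinAt_id t _).smul_const A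
    rw [one_smul] at h
    exact h.derivWithin (uniqueDiffOn_Icc (by linarith) t ht)
  obtain ⟨σ, hσa, hσ⟩ := hV (2 * a) (by linarith) (fun t => t • A)
    ⟨(contDiff_id.smul contDiff_const).contDiffOn, fun t _ => (freeNilpotent d κ).smul_mem t hA⟩
    a ⟨ha.le, by linarith⟩ m
  have hσ' : IsMIntegralCurveOn σ (extendVF V A) (Icc 0 (2 * a)) := by
    intro t ht
    have := hσ t ht
    simp only [velocityField] at this
    rw [hvel t ht] at this
    exact this
  refine ⟨fun t => σ (t + a), by simpa using hσa, (hσ'.comp_add a).mono fun t ht => ?_⟩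
  exact ⟨by linarith [ht.1], by linarith [ht.2]⟩

/-! ### Flows and logarithms of solutions of `g' = g b` -/

/-- Two paths, `g` in the group with `g' = g b` and `σ` in `M` with `σ' = V_b(σ)`. By the first
variation formula the path `t ↦ e^{-V_c} (σ t)` with `c = log g` has velocity zero. -/
theorem eq_expFlow_log_of_development (hκ : 1 ≤ κ) (hcomplete : IsKappaComplete κ V)
    (hnilp : GeneratesNilpotent κ V) {T : ℝ} (hT : 0 < T) {g b : ℝ → TruncTensor d κ}
    (hg : ∀ t ∈ Icc 0 T, HasDerivWithinAt g (g t * b t) (Icc 0 T) t)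
    (hg1 : ∀ t ∈ Icc 0 T, g t - 1 ∈ degGE d κ 1) (hb : ∀ t ∈ Icc 0 T, b t ∈ freeNilpotent d κ)
    (h0 : log (g 0) ∈ freeNilpotent d κ) {σ : ℝ → M}
    (hσ : ∀ t ∈ Icc 0 T, HasVelocityWithinAt σ (extendVF V (b t)).toOperator (Icc 0 T) t)
    {t : ℝ} (ht : t ∈ Icc 0 T) :
    log (g t) ∈ freeNilpotent d κ ∧
      σ t = expFlow (⇑(extendVF V (log (g t)))) (expFlow (⇑(extendVF V (-log (g 0)))) (σ 0)) := by
  obtain ⟨c', hc'⟩ := exists_hasDerivWithinAt_log_of_development freeNilpotent_le_augmentation hT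
    hg hg1 hb h0
  set c : ℝ → TruncTensor d κ := fun t => log (g t)
  set F := freeNilpotent d κ
  have hnegF : ∀ {A : TruncTensor d κ}, A ∈ F → -A ∈ F := fun hA =>
    F.toSubmodule.neg_mem hA
  set ρ := truncOperator κ V
  have hX : ∀ {A : TruncTensor d κ}, A ∈ F → (extendVF V A).toOperator = ρ A := fun hA =>
    hnilp.toOperator_extendVF_eq_truncOperator hκ hA
  have hcF : ∀ t ∈ Icc 0 T, c t ∈ F := fun t ht => (hc' t ht).1
  refine ⟨hcF t ht, ?_⟩
  have hex : ∀ h, ∃ η : ℝ → M,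
      h ∈ Icc 0 T → η 0 = σ h ∧ IsMIntegralCurve η (extendVF V (-c h)) := by
    intro h
    by_cases hh : h ∈ Icc 0 T
    · obtain ⟨η, hη⟩ := hcomplete.exists_isMIntegralCurve (hnegF (hcF h hh)) (σ h)
      exact ⟨η, fun _ => hη⟩
    · exact ⟨fun _ => σ h, fun h' => absurd h' hh⟩
  choose y hy using hex
  have hvel : ∀ t ∈ Icc 0 T, HasVelocityWithinAt (fun h => y h 1) (ρ 0) (Icc 0 T) t := by
    intro t ht
    obtain ⟨h1, h2, h3, h4⟩ := hc' t ht
    have hmem1 := mem_degGE_one_of_mem_freeNilpotent h1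
    have hmem2 := mem_degGE_one_of_mem_freeNilpotent h2
    have hzF (s : ℝ) : dexp (c t) (c' t) (1 - s) ∈ F := dexp_mem_lieSubalgebra F h1 h2 _
    -- the solution of the linearized equation along the flow of `-V_c` in the direction `-V_c'`
    -- starts at `dexp c c' 1 = b`, the velocity of `σ`, and vanishes at `s = 1`
    have key := hasVelocityWithinAt_of_variation ρ (a' := -c' t)
      (z := fun s => dexp (c t) (c' t) (1 - s))
      (z' := fun s => ⁅c t, dexp (c t) (c' t) (1 - s)⁆ - c' t) (A := fun h => -c h)
      (S := Icc 0 T) (t := t) ht ⟨_, hX (hnegF h1)⟩ (fun s _ => ⟨_, hX (hzF s)⟩) (fun s => ?_)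
      (fun s _ => ?_) h3.neg (y := y) (fun h hh s => ?_) ?_
    · simpa [dexp_zero] using key
    · have := (hasDerivAt_dexp hmem1 hmem2 (1 - s)).scomp s
        ((hasDerivAt_id s).const_sub 1)
      simp only [neg_smul, one_smul, neg_sub] at this
      exact this
    · have hlie : ρ ⁅c t, dexp (c t) (c' t) (1 - s)⁆
          = ρ (c t) * ρ (dexp (c t) (c' t) (1 - s)) - ρ (dexp (c t) (c' t) (1 - s)) * ρ (c t) :=
        hnilp.map_toTensor_lie hκ h1 (hzF s)
      rw [map_sub, map_neg, map_neg, hlie]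
      have cancel {R : Type _} [Ring R] (P Z D : R) :
          P * Z - Z * P - D + -P * Z - Z * -P = -D := by
        rw [neg_mul, mul_neg]
        abel
      exact cancel _ _ _
    · rw [← hX (hnegF (hcF h hh))]
      exact (solvesODEOn_univ_iff.2 (hy h hh).2).hasVelocityWithinAt
        (X := fun _ => extendVF V (-c h)) (mem_univ s)
    · intro f
      have h5 := hσ t ht f
      rw [hX (hb t ht), ← h4] at h5
      simp only [sub_zero]
      rw [(hy t ht).1]
      exact h5.congr (fun h hh => by rw [(hy h hh).1]) (by rw [(hy t ht).1])
  have hconst : y t 1 = y 0 1 := by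
    by_contra hne
    obtain ⟨f, hf1, hf0⟩ := exists_smooth_bump (E := E) (isOpen_compl_singleton.mem_nhds hne)
    have hd : ∀ s ∈ Icc 0 T, HasDerivWithinAt (fun h => f (y h 1)) 0 (Icc 0 T) s := by
      intro s hs
      have := hvel s hs f
      rwa [map_zero] at this
    have := (convex_Icc (0 : ℝ) T).norm_image_sub_le_of_norm_hasDerivWithin_le (C := 0) hd
      (by simp) (left_mem_Icc.2 hT.le) ht
    rw [hf1, hf0 _ (by simp)] at this
    norm_num at this
  have hT0 : (0 : ℝ) ∈ Icc 0 T := left_mem_Icc.2 hT.le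
  have e1 : expFlow (⇑(extendVF V (-c 0))) (σ 0) = y 0 1 := by
    rw [← (hy 0 hT0).1]
    exact (hy 0 hT0).2.expFlow_eq
  have e2 : expFlow (⇑(extendVF V (c t))) (y t 1) = σ t := by
    have := (hy t ht).2.expFlow_neg
    rwa [hnilp.extendVF_neg hκ (hcF t ht), neg_neg, (hy t ht).1] at this
  change σ t = expFlow (⇑(extendVF V (c t))) (expFlow (⇑(extendVF V (-c 0))) (σ 0))
  rw [e1, ← hconst, e2]

end NilpotentSystem

namespace TruncTensor

variable {d κ : ℕ}

theorem IsC1Path.hasDerivWithinAt {T : ℝ} {ξ : ℝ → TruncTensor d κ} (hξ : IsC1Path T ξ) {t : ℝ}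
    (ht : t ∈ Icc 0 T) : HasDerivWithinAt ξ (velocity T ξ t) (Icc 0 T) t :=
  ((hξ.1.differentiableOn (by simp)) t ht).hasDerivWithinAt

theorem IsC1Path.velocity_mem {T : ℝ} (hT : 0 < T) {ξ : ℝ → TruncTensor d κ} (hξ : IsC1Path T ξ)
    {t : ℝ} (ht : t ∈ Icc 0 T) : velocity T ξ t ∈ freeNilpotent d κ :=
  hasDerivWithinAt_mem (freeNilpotent d κ).toSubmodule hT ht (hξ.hasDerivWithinAt ht) hξ.2

/-- The equation `g' = g ξ'` has a solution, so `development` is not its junk value. -/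
theorem IsC1Path.isDevelopment_development {T : ℝ} (hT : 0 < T) {ξ : ℝ → TruncTensor d κ}
    (hξ : IsC1Path T ξ) : IsDevelopment T ξ (development T ξ) := by
  have hcont : ContinuousOn (velocity T ξ) (Icc 0 T) :=
    hξ.1.continuousOn_derivWithin (uniqueDiffOn_Icc hT) le_rfl
  have hb : Continuous fun t => velocity T ξ (projIcc 0 T hT.le t) :=
    hcont.comp_continuous (continuous_subtype_val.comp continuous_projIcc)
      fun t => (projIcc 0 T hT.le t).2
  obtain ⟨g, hg0, hg⟩ := exists_development hb fun t =>
    mem_degGE_one_of_mem_freeNilpotent (hξ.velocity_mem hT (projIcc 0 T hT.le t).2)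
  have h : ∃ g, IsDevelopment T ξ g := ⟨g, hg0, fun t ht => by
    have := (hg t).hasDerivWithinAt (s := Icc 0 T)
    rwa [projIcc_of_mem hT.le ht] at this⟩
  rw [development, dif_pos h]
  exact h.choose_spec

end TruncTensor

end

theorem corollary4p8 {E : Type*} [NormedAddCommGroup E] [NormedSpace ℝ E] [FiniteDimensional ℝ E]
    {M : Type*} [TopologicalSpace M] [T2Space M] [SecondCountableTopology M]
    [ConnectedSpace M] [ChartedSpace E M] [IsManifold 𝓘(ℝ, E) ∞ M]
    (d κ : ℕ) (hκ : 1 ≤ κ) (V : (Fin d → ℝ) →ₗ[ℝ] SmoothVectorField E M)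
    (hcomplete : IsKappaComplete κ V) (hnilp : GeneratesNilpotent κ V) :
    (∀ (T : ℝ), 0 < T → ∀ ξ : ℝ → TruncTensor d κ, TruncTensor.IsC1Path T ξ →
      ∀ t ∈ Icc 0 T,
        TruncTensor.logDevelopment T ξ t ∈ TruncTensor.freeNilpotent d κ ∧
        flow (velocityField V T ξ) (Icc 0 T) t 0 =
          expFlow (⇑(extendVF V (TruncTensor.logDevelopment T ξ t)))) ∧
    (∀ A B : TruncTensor d κ, A ∈ TruncTensor.freeNilpotent d κ →
      B ∈ TruncTensor.freeNilpotent d κ →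
      TruncTensor.log (TruncTensor.exp A * TruncTensor.exp B) ∈ TruncTensor.freeNilpotent d κ ∧
      expFlow (⇑(extendVF V B)) ∘ expFlow (⇑(extendVF V A)) =
        expFlow (⇑(extendVF V
          (TruncTensor.log (TruncTensor.exp A * TruncTensor.exp B))))) := by
  constructor
  · intro T hT ξ hξ t ht
    have hdev := hξ.isDevelopment_development hT
    set g := TruncTensor.development T ξ with hg
    have hvel : ∀ s ∈ Icc 0 T, TruncTensor.velocity T ξ s ∈ TruncTensor.freeNilpotent d κ :=
      fun s hs => hξ.velocity_mem hT hs
    have hg1 : ∀ s ∈ Icc 0 T, g s - 1 ∈ TruncTensor.degGE d κ 1 :=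
      TruncTensor.mem_of_hasDerivWithinAt_mem _ (fun s hs => (hdev.2 s hs).sub_const 1)
        (by rw [hdev.1, sub_self]; exact zero_mem _) fun s hs =>
          TruncTensor.mul_mem_degGE_left _
            (TruncTensor.mem_degGE_one_of_mem_freeNilpotent (hvel s hs))
    have h0 : TruncTensor.log (g 0) = 0 := by rw [hdev.1, TruncTensor.log_one]
    have hsolve (m : M) : ∃ σ : ℝ → M, σ 0 = m ∧ SolvesODEOn (velocityField V T ξ) (Icc 0 T) σ :=
      hcomplete T hT ξ hξ 0 (left_mem_Icc.2 hT.le) m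
    have key {σ : ℝ → M} (hσ : SolvesODEOn (velocityField V T ξ) (Icc 0 T) σ) :=
      eq_expFlow_log_of_development hκ hcomplete hnilp hT hdev.2 hg1 hvel
        (by rw [h0]; exact zero_mem _) (σ := σ)
        (fun s hs => hσ.hasVelocityWithinAt
          (X := fun s => extendVF V (TruncTensor.velocity T ξ s)) hs)
        ht
    constructor
    · obtain ⟨m⟩ := (inferInstance : Nonempty M)
      obtain ⟨σ, -, hσ⟩ := hsolve m
      exact (key hσ).1
    · funext m
      rw [flow, dif_pos (hsolve m), (key (hsolve m).choose_spec.2).2, h0, neg_zero,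
        hnilp.extendVF_zero hκ, expFlow_zero, (hsolve m).choose_spec.1]
      rfl
  · -- along `g t = e^A e^{tB}`, followed by the integral curves of `V_B`
    intro A B hA hB
    have hA1 := TruncTensor.mem_degGE_one_of_mem_freeNilpotent hA
    have hB1 := TruncTensor.mem_degGE_one_of_mem_freeNilpotent hB
    have h0 : TruncTensor.log (TruncTensor.exp A * TruncTensor.exp ((0 : ℝ) • B)) = A := by
      rw [zero_smul, TruncTensor.exp_zero, mul_one, TruncTensor.log_exp hA1]
    have key {σ : ℝ → M} (hσ : IsMIntegralCurve σ (extendVF V B)) :=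
      eq_expFlow_log_of_development hκ hcomplete hnilp one_pos
        (g := fun t : ℝ => TruncTensor.exp A * TruncTensor.exp (t • B)) (b := fun _ => B)
        (fun t _ => by
          have := TruncTensor.hasDerivWithinAt_mul
            (hasDerivWithinAt_const t (Icc (0 : ℝ) 1) (TruncTensor.exp A))
            (TruncTensor.hasDerivWithinAt_exp_smul (t := t) hB1)
          rwa [zero_mul, zero_add, ← mul_assoc] at this)
        (fun t _ => TruncTensor.mul_sub_one_mem (TruncTensor.exp_sub_one_mem hA1)
          (TruncTensor.exp_sub_one_mem (Submodule.smul_mem _ _ hB1)))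
        (fun _ _ => hB) (by rw [h0]; exact hA) (σ := σ)
        (fun t ht => SolvesODEOn.hasVelocityWithinAt (X := fun _ => extendVF V B)
          (fun s _ => (hσ s).hasMFDerivWithinAt) ht)
        (right_mem_Icc.2 zero_le_one)
    constructor
    · obtain ⟨m⟩ := (inferInstance : Nonempty M)
      obtain ⟨σ, -, hσ⟩ := hcomplete.exists_isMIntegralCurve hB m
      have := (key hσ).1
      rwa [one_smul] at this
    · funext m
      obtain ⟨τ, hτ0, hτ⟩ := hcomplete.exists_isMIntegralCurve hA m
      obtain ⟨σ, hσ0, hσ⟩ := hcomplete.exists_isMIntegralCurve hB (τ 1)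
      have h := (key hσ).2
      rw [h0, one_smul, hσ0, hnilp.extendVF_neg hκ hA, hτ.expFlow_neg, hτ0] at h
      rw [Function.comp_apply, ← hτ0, hτ.expFlow_eq, ← hσ0, hσ.expFlow_eq, h, hτ0]
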